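/- **Setup.** Let $n\ge 0$, $k\ge 1$, and let $\lambda^{(1)}/\mu^{(1)},\dots,\lambda^{(k)}/\mu^{(k)}$ be skew shapes with $\ell(\lambda^{(r)})\le n$ (so $\mu^{(r)}\subseteq\lambda^{(r)}$) that are $(3\times2)$-avoiding, i.e. contain no block of cells with $3$ rows and $2$ columns. Let $\vec x^{(1)},\dots,\vec x^{(k)}$ be independent infinite sequences of variables. *Matrices.* $JT_{\lambda/\mu}(\vec x)=\big(e_{\lambda_i-\mu_j-i+j}(\vec x)\big)_{i,j=1}^n$, where $e_d$ is the elementary symmetric function ($e_0=1$, $e_d=0$ for $d<0$), and $M$ is the Hadamard (entrywise) product $JT_{\lambda^{(1)}/\mu^{(1)}}(\vec x^{(1)})*\cdots*JT_{\lambda^{(k)}/\mu^{(k)}}(\vec x^{(k)})$. *Temperley–Lieb immanants.* Permutations are composed from left to right and $s_i=(i,i+1)$. $TL_n(2)$ is the $\mathbb C$-algebra generated by $t_1,\dots,t_{n-1}$ with $t_i^2=2t_i$, $t_it_jt_i=t_i$ for $|i-j|=1$, and $t_it_j=t_jt_i$ for $|i-j|\ge2$; it has the basis $\mathcal B_n$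 of Kauffman diagrams (noncrossing perfect matchings of $n$ left and $n$ right boundary points, multiplied by concatenation with a factor $2$ for every closed loop). Let $\theta:\mathbb C[\mathfrak S_n]\to TL_n(2)$ be the algebra homomorphism with $\theta(s_i)=t_i-1$. For $\tau\in\mathcal B_n$, $f_\tau(w)$ is the coefficient of $\tau$ in $\theta(w)$, and $\mathrm{imm}_\tau(A)=\sum_{w\in\mathfrak S_n}f_\tau(w)A_{1,w(1)}\cdots A_{n,w(n)}$. For $I\subseteq[n-1]$ put $B(I)=\prod_{i\in I}(1+s_i)$ and $\tau(I)=\theta(B(I))=\prod_{i\in I}t_i$, with products in increasing order from left to right. *Multinetworks.* Lattice paths have south steps $(a,b)\to(a,b-1)$, of weight $1$, and southwest steps $(a,b)\to(a-1,b-1)$, of weight $x_b$. A $(\lambda,\mu)$-path family of type $\sigma\in\mathfrak S_n$ is a tuple of paths $p_i:(\lambda_i+n-i,\infty)\to(\mu_{\sigma(i)}+n-\sigma(i),0)$, $1\le i\le n$ (vertical far up). A $(\lambda,\mu)$-subnetwork $H$ is a multiset of edges that is the disjoint union of the paths of some $(\lambda,\mu)$-path family; such a family is said to cover $H$. Its weight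 $\mathrm{wt}(H)$ is the product of the weights of its edges, and $\beta(H)\in\mathbb C[\mathfrak S_n]$ is the sum of the types of all path families covering $H$. If $\theta(\beta(H))=2^{\varepsilon}\psi$ with $\psi\in\mathcal B_n$, put $\varepsilon(H)=\varepsilon$. A multinetwork is a tuple $\vec H=(H^{(1)},\dots,H^{(k)})$ of $(\lambda^{(r)},\mu^{(r)})$-subnetworks $H^{(r)}$; $\beta(\vec H)$ is the sum, over all tuples $(\vec p^{(1)},\dots,\vec p^{(k)})$ of path families of one common type with $\vec p^{(r)}$ covering $H^{(r)}$ for all $r$, of that common type; $\varepsilon(\vec H)=\sum_r\varepsilon(H^{(r)})$ and $\mathrm{wt}(\vec H)=\prod_r\mathrm{wt}(H^{(r)})(\vec x^{(r)})$. **Theorem.** Every component $H^{(r)}$ of every multinetwork satisfies $\theta(\beta(H^{(r)}))=2^{\varepsilon}\psi$ for some $\varepsilon\ge0$ and $\psi\in\mathcal B_n$, so that $\varepsilon(\vec H)$ is defined, and for every $\tau\in\mathcal B_n$: 1. if $\tau=\tau(I)$ for some $I\subseteq[n-1]$, then $$\mathrm{imm}_\tau(M)=\sum_{\vec H}2^{\varepsilon(\vec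 H)}\,\mathrm{wt}(\vec H),$$ the (formal, in general infinite) sum being over all multinetworks $\vec H$ with $\beta(\vec H)=2^{\varepsilon(\vec H)}B(I)$; 2. if $\tau$ is not of the form $\tau(I)$, then $\mathrm{imm}_\tau(M)=0$; 3. $\mathrm{imm}_\tau(M)$ is monomial positive: it is a finite linear combination with nonnegative coefficients of products $m_{\nu^{(1)}}(\vec x^{(1)})\cdots m_{\nu^{(k)}}(\vec x^{(k)})$ of monomial symmetric functions. In particular $\det M$ is a finite linear combination of such products with nonnegative integer coefficients; that is, Sokal's conjecture holds for these shapes. -/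

import Mathlib

namespace TLImm

/-- The adjacent transposition `s_i = (i, i+1)`; indices `i` run over `Fin (n - 1)`, i.e. `0, …, n-2`. -/
def adjSwap (n : ℕ) (i : Fin (n - 1)) : Equiv.Perm (Fin n) :=
  Equiv.swap ⟨i, by omega⟩ ⟨i + 1, by omega⟩

/-! ### The Coxeter presentation of the symmetric group

Used only to know that a family satisfying the Coxeter relations defines a homomorphism. -/

section Lift
variable {M : Type*} [Monoid M]

/-- The product `m_{p-1} ⋯ m_1 m_0`. -/
def cyc (m : ℕ → M) : ℕ → M
  | 0 => 1
  | p + 1 => m p * cyc m p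

/-- The Coxeter relations of type `A` for `m_0, …, m_{n-1}`. -/
def CoxRel (n : ℕ) (m : ℕ → M) : Prop :=
  (∀ i, i < n → m i * m i = 1) ∧
  (∀ i, i + 1 < n → m i * m (i + 1) * m i = m (i + 1) * m i * m (i + 1)) ∧
  (∀ i j, i + 1 < j → j < n → m i * m j = m j * m i)

theorem cyc_comm {n : ℕ} {m : ℕ → M} (h : CoxRel n m) (i : ℕ) (hi : i < n) :
    ∀ p, p < i → m i * cyc m p = cyc m p * m i
  | 0, _ => by simp [cyc]
  | p + 1, hp => by
    have ih := cyc_comm h i hi p (by omega)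
    simp only [cyc]
    rw [← mul_assoc, ← h.2.2 p i (by omega) hi, mul_assoc, ih, mul_assoc]

theorem cyc_shift {n : ℕ} {m : ℕ → M} (h : CoxRel n m) (i : ℕ) :
    ∀ p, i + 1 < p → p ≤ n → m i * cyc m p = cyc m p * m (i + 1)
  | 0, hp, _ => by omega
  | 1, hp, _ => by omega
  | p + 2, hp, hn => by
    rcases Nat.eq_or_lt_of_le (show i ≤ p by omega) with rfl | hlt
    · have e := cyc_comm h (i + 1) (by omega) i (by omega)
      simp only [cyc]
      calc m i * (m (i + 1) * (m i * cyc m i)) = (m i * m (i + 1) * m i) * cyc m i := by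
            simp only [mul_assoc]
        _ = m (i + 1) * (m i * (m (i + 1) * cyc m i)) := by
            rw [h.2.1 i (by omega)]; simp only [mul_assoc]
        _ = _ := by rw [e]; simp only [mul_assoc]
    · have ih := cyc_shift h i (p + 1) (by omega) (by omega)
      rw [cyc, ← mul_assoc, h.2.2 i (p + 1) (by omega) (by omega), mul_assoc, ih, mul_assoc]

/-- adjacent transpositions indexed by `ℕ`, trivial out of range -/
def sw (n i : ℕ) : Equiv.Perm (Fin n) :=
  if h : i + 1 < n then Equiv.swap ⟨i, by omega⟩ ⟨i + 1, h⟩ else 1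

theorem sw_apply {n i : ℕ} (h : i + 1 < n) (x : Fin n) :
    ((sw n i x : Fin n) : ℕ) = if (x : ℕ) = i then i + 1 else if (x : ℕ) = i + 1 then i else x := by
  rw [sw, dif_pos h, Equiv.swap_apply_def]
  simp only [Fin.ext_iff]
  split_ifs <;> rfl

theorem sw_cox (n : ℕ) : CoxRel (n - 1) (sw n) := by
  refine ⟨fun i hi => ?_, fun i hi => ?_, fun i j hij hj => ?_⟩
  · ext x
    simp only [Equiv.Perm.mul_apply, Equiv.Perm.one_apply]
    rw [sw_apply (by omega), sw_apply (by omega)]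
    split_ifs <;> omega
  · ext x
    simp only [Equiv.Perm.mul_apply]
    rw [sw_apply (by omega), sw_apply (by omega), sw_apply (by omega),
      sw_apply (by omega), sw_apply (by omega), sw_apply (by omega)]
    split_ifs <;> omega
  · ext x
    simp only [Equiv.Perm.mul_apply]
    rw [sw_apply (by omega), sw_apply (by omega), sw_apply (by omega), sw_apply (by omega)]
    split_ifs <;> omega

/-- A permutation of `{0, …, n-1}` acting on `{1, …, n}`. -/
def ext0 {n : ℕ} (σ : Equiv.Perm (Fin n)) : Equiv.Perm (Fin (n + 1)) :=
  Equiv.Perm.decomposeFin.symm (0, σ)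

theorem ext0_zero {n : ℕ} (σ : Equiv.Perm (Fin n)) : ext0 σ 0 = 0 := by simp [ext0]

theorem ext0_succ {n : ℕ} (σ : Equiv.Perm (Fin n)) (x : Fin n) : ext0 σ x.succ = (σ x).succ := by
  simp [ext0]

theorem ext0_inj {n : ℕ} {σ τ : Equiv.Perm (Fin n)} (h : ext0 σ = ext0 τ) : σ = τ := by
  have := Equiv.Perm.decomposeFin.symm.injective h
  simpa using this

theorem ext0_sw {n i : ℕ} (h : i + 1 < n) (σ : Equiv.Perm (Fin n)) :
    ext0 (sw n i * σ) = sw (n + 1) (i + 1) * ext0 σ := by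
  ext x
  refine Fin.cases ?_ (fun y => ?_) x
  · rw [Equiv.Perm.mul_apply, ext0_zero, ext0_zero, sw_apply (by omega)]
    simp
  · rw [Equiv.Perm.mul_apply, ext0_succ, ext0_succ, sw_apply (by omega), Fin.val_succ,
      Equiv.Perm.mul_apply, sw_apply h, Fin.val_succ]
    split_ifs <;> omega

theorem ext0_one {n : ℕ} : ext0 (1 : Equiv.Perm (Fin n)) = 1 := by
  ext x
  refine Fin.cases ?_ (fun y => ?_) x <;> simp [ext0_zero, ext0_succ]

theorem cyc_sw_zero {n : ℕ} : ∀ p, p < n + 1 → ((cyc (sw (n + 1)) p 0 : Fin (n + 1)) : ℕ) = p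
  | 0, _ => by simp [cyc]
  | p + 1, h => by
    rw [cyc, Equiv.Perm.mul_apply, sw_apply (by omega), cyc_sw_zero p (by omega)]
    simp

theorem sw_step {n i p : ℕ} (hi : i < n) (hp : p < n + 1) (σ : Equiv.Perm (Fin n)) :
    ∃ q τ, q < n + 1 ∧ sw (n + 1) i * (cyc (sw (n + 1)) p * ext0 σ) =
        cyc (sw (n + 1)) q * ext0 τ ∧
      ∀ (m : ℕ → M), CoxRel n m → ∀ g : Equiv.Perm (Fin n) →* M,
        (∀ j, j + 1 < n → g (sw n j) = m (j + 1)) →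
        m i * (cyc m p * g σ) = cyc m q * g τ := by
  have hs : CoxRel n (sw (n + 1)) := sw_cox (n + 1)
  rcases lt_trichotomy i p with h | rfl | h
  · rcases Nat.eq_or_lt_of_le (show i + 1 ≤ p from h) with rfl | h'
    · refine ⟨i, σ, by omega, ?_, fun m hm g hg => ?_⟩
      · rw [cyc, ← mul_assoc, ← mul_assoc, hs.1 i hi, one_mul]
      · rw [cyc, ← mul_assoc, ← mul_assoc, hm.1 i hi, one_mul]
    · refine ⟨p, sw n i * σ, hp, ?_, fun m hm g hg => ?_⟩
      · rw [← mul_assoc, cyc_shift hs i p h' (by omega), mul_assoc, ext0_sw (by omega)]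
      · rw [← mul_assoc, cyc_shift hm i p h' (by omega), mul_assoc, map_mul, hg i (by omega)]
  · refine ⟨i + 1, σ, by omega, ?_, fun m hm g hg => ?_⟩
    · rw [cyc, mul_assoc]
    · rw [cyc, mul_assoc]
  · obtain ⟨j, rfl⟩ : ∃ j, i = j + 1 := ⟨i - 1, by omega⟩
    refine ⟨p, sw n j * σ, hp, ?_, fun m hm g hg => ?_⟩
    · rw [← mul_assoc, cyc_comm hs _ hi p h, mul_assoc, ext0_sw (by omega)]
    · rw [← mul_assoc, cyc_comm hm _ hi p h, mul_assoc, map_mul, hg j (by omega)]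

theorem sw_induction {n : ℕ} {P : Equiv.Perm (Fin (n + 1)) → Prop} (h1 : P 1)
    (hs : ∀ i, i < n → ∀ σ, P σ → P (sw (n + 1) i * σ)) (σ : Equiv.Perm (Fin (n + 1))) : P σ := by
  have hσ : σ ∈ Submonoid.closure
      (Set.range fun i : Fin n => Equiv.swap i.castSucc i.succ) := by
    rw [Equiv.Perm.mclosure_swap_castSucc_succ]; trivial
  induction hσ using Submonoid.closure_induction_left with
  | one => exact h1
  | mul_left x hx y _ ih =>
    obtain ⟨i, rfl⟩ := hx
    have := hs i i.2 y ih
    rw [sw, dif_pos (by omega)] at this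
    exact this

/-- The symmetric group has the Coxeter presentation. -/
theorem exists_lift : ∀ (n : ℕ) (m : ℕ → M), CoxRel (n - 1) m →
    ∃ f : Equiv.Perm (Fin n) →* M, ∀ i, i + 1 < n → f (sw n i) = m i
  | 0, m, _ => ⟨1, fun i hi => by omega⟩
  | n + 1, m, hm => by
    have hm : CoxRel n m := hm
    obtain ⟨g, hg⟩ := exists_lift n (fun i => m (i + 1))
      ⟨fun i hi => hm.1 _ (by omega), fun i hi => hm.2.1 _ (by omega),
        fun i j hij hj => hm.2.2 _ _ (by omega) (by omega)⟩
    have dec : ∀ σ : Equiv.Perm (Fin (n + 1)), ∃ p τ, p < n + 1 ∧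
        σ = cyc (sw (n + 1)) p * ext0 τ := by
      apply sw_induction
      · exact ⟨0, 1, by omega, by simp [cyc, ext0_one]⟩
      · rintro i hi _ ⟨p, τ, hp, rfl⟩
        obtain ⟨q, τ', hq, h, -⟩ := sw_step (M := M) hi hp τ
        exact ⟨q, τ', hq, h⟩
    choose p τ hp hσ using dec
    have key : ∀ q ρ, q < n + 1 →
        cyc m (p (cyc (sw (n + 1)) q * ext0 ρ)) * g (τ (cyc (sw (n + 1)) q * ext0 ρ)) =
          cyc m q * g ρ := by
      intro q ρ hq
      have h := hσ (cyc (sw (n + 1)) q * ext0 ρ)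
      have h0 := congrArg (fun s : Equiv.Perm (Fin (n + 1)) => ((s 0 : Fin (n + 1)) : ℕ)) h
      simp only [Equiv.Perm.mul_apply, ext0_zero] at h0
      rw [cyc_sw_zero _ hq, cyc_sw_zero _ (hp _)] at h0
      rw [← h0] at h ⊢
      rw [← ext0_inj (mul_left_cancel h)]
    have step : ∀ i, i < n → ∀ σ, cyc m (p (sw (n + 1) i * σ)) * g (τ (sw (n + 1) i * σ)) =
        m i * (cyc m (p σ) * g (τ σ)) := by
      intro i hi σ
      obtain ⟨q, ρ, hq, h, h'⟩ := sw_step (M := M) hi (hp σ) (τ σ)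
      rw [h' m hm g hg, ← key q ρ hq, ← h, ← hσ]
    have h1 : cyc m (p 1) * g (τ 1) = 1 := by
      have := key 0 1 (by omega)
      simpa [cyc, ext0_one] using this
    refine ⟨⟨⟨fun σ => cyc m (p σ) * g (τ σ), h1⟩, fun σ ρ => ?_⟩, fun i hi => ?_⟩
    · refine sw_induction (P := fun σ => cyc m (p (σ * ρ)) * g (τ (σ * ρ)) =
        cyc m (p σ) * g (τ σ) * (cyc m (p ρ) * g (τ ρ))) ?_ ?_ σ
      · rw [h1, one_mul, one_mul]
      · intro i hi σ ih
        rw [mul_assoc, step i hi, ih, step i hi]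
        simp only [mul_assoc]
    · have := step i (by omega) 1
      rw [h1, mul_one, mul_one] at this
      exact this

end Lift

/-! ### The Temperley-Lieb algebra at parameter `2` -/

/-- The defining relations of the Temperley-Lieb algebra with parameter `2`. -/
inductive TLRel (n : ℕ) : FreeAlgebra ℂ (Fin (n - 1)) → FreeAlgebra ℂ (Fin (n - 1)) → Prop
  | sq (i : Fin (n - 1)) :
      TLRel n (FreeAlgebra.ι ℂ i * FreeAlgebra.ι ℂ i) ((2 : ℂ) • FreeAlgebra.ι ℂ i)
  | adjacent (i j : Fin (n - 1)) (h : (i : ℕ) + 1 = j ∨ (j : ℕ) + 1 = i) :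
      TLRel n (FreeAlgebra.ι ℂ i * FreeAlgebra.ι ℂ j * FreeAlgebra.ι ℂ i) (FreeAlgebra.ι ℂ i)
  | distant (i j : Fin (n - 1)) (h : (i : ℕ) + 2 ≤ j ∨ (j : ℕ) + 2 ≤ i) :
      TLRel n (FreeAlgebra.ι ℂ i * FreeAlgebra.ι ℂ j) (FreeAlgebra.ι ℂ j * FreeAlgebra.ι ℂ i)

/-- The Temperley-Lieb algebra `TL_n(2)` over `ℂ`, by generators and relations. -/
abbrev TL (n : ℕ) : Type := RingQuot (TLRel n)

/-- The generator `t_i` of `TL_n(2)`. -/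
noncomputable def tGen (n : ℕ) (i : Fin (n - 1)) : TL n :=
  RingQuot.mkAlgHom ℂ (TLRel n) (FreeAlgebra.ι ℂ i)

theorem tGen_sq {n : ℕ} (i : Fin (n - 1)) : tGen n i * tGen n i = (2 : ℂ) • tGen n i := by
  simpa [tGen] using RingQuot.mkAlgHom_rel ℂ (TLRel.sq (n := n) i)

theorem tGen_adjacent {n : ℕ} {i j : Fin (n - 1)} (h : (i : ℕ) + 1 = j ∨ (j : ℕ) + 1 = i) :
    tGen n i * tGen n j * tGen n i = tGen n i := by
  simpa [tGen] using RingQuot.mkAlgHom_rel ℂ (TLRel.adjacent (n := n) i j h)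

theorem tGen_distant {n : ℕ} {i j : Fin (n - 1)} (h : (i : ℕ) + 2 ≤ j ∨ (j : ℕ) + 2 ≤ i) :
    tGen n i * tGen n j = tGen n j * tGen n i := by
  simpa [tGen] using RingQuot.mkAlgHom_rel ℂ (TLRel.distant (n := n) i j h)

/-- `ℂ[𝔖_n]` for permutations composed from left to right: `s_1 s_2` first applies `s_1`. -/
abbrev SymAlg (n : ℕ) : Type := MonoidAlgebra ℂ (Equiv.Perm (Fin n))ᵐᵒᵖ

/-- The permutation `w`, as an element of `ℂ[𝔖_n]`. -/
noncomputable def perm {n : ℕ} (w : Equiv.Perm (Fin n)) : SymAlg n :=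
  MonoidAlgebra.of ℂ (Equiv.Perm (Fin n))ᵐᵒᵖ (MulOpposite.op w)

theorem exists_theta (n : ℕ) :
    ∃ θ : SymAlg n →ₐ[ℂ] TL n, ∀ i : Fin (n - 1), θ (perm (adjSwap n i)) = tGen n i - 1 := by
  set m : ℕ → (TL n)ᵐᵒᵖ := fun i =>
    MulOpposite.op (if h : i < n - 1 then tGen n ⟨i, h⟩ - 1 else 1) with hm
  have key (i j : Fin (n - 1)) (h : (i : ℕ) + 1 = j ∨ (j : ℕ) + 1 = i) :
      (tGen n i - 1) * (tGen n j - 1) * (tGen n i - 1) =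
        tGen n i + tGen n j - tGen n i * tGen n j - tGen n j * tGen n i - 1 := by
    calc _ = tGen n i * tGen n j * tGen n i - tGen n i * tGen n i - tGen n i * tGen n j
          - tGen n j * tGen n i + (2 : ℂ) • tGen n i + tGen n j - 1 := by
            simp only [two_smul, mul_sub, sub_mul, mul_one, one_mul, mul_assoc]; abel
      _ = _ := by rw [tGen_sq, tGen_adjacent h]; abel
  have hc : CoxRel (n - 1) m := by
    refine ⟨fun i hi => ?_, fun i hi => ?_, fun i j hij hj => ?_⟩
    · simp only [hm, dif_pos hi, ← MulOpposite.op_mul, ← MulOpposite.op_one]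
      congr 1
      calc _ = tGen n ⟨i, hi⟩ * tGen n ⟨i, hi⟩ - (2 : ℂ) • tGen n ⟨i, hi⟩ + 1 := by
            simp only [two_smul, mul_sub, sub_mul, mul_one, one_mul, mul_assoc]; abel
        _ = 1 := by rw [tGen_sq]; abel
    · simp only [hm, dif_pos hi, dif_pos (show i < n - 1 by omega), ← MulOpposite.op_mul]
      congr 1
      rw [← mul_assoc, ← mul_assoc, key ⟨i, by omega⟩ ⟨i + 1, hi⟩ (Or.inl rfl),
        key ⟨i + 1, hi⟩ ⟨i, by omega⟩ (Or.inr rfl)]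
      abel
    · simp only [hm, dif_pos hj, dif_pos (show i < n - 1 by omega), ← MulOpposite.op_mul]
      congr 1
      have := tGen_distant (n := n) (i := ⟨i, by omega⟩) (j := ⟨j, hj⟩) (Or.inl hij)
      simp only [mul_sub, sub_mul, this, mul_one, one_mul]
      abel
  obtain ⟨f, hf⟩ := exists_lift n m hc
  refine ⟨MonoidAlgebra.lift ℂ (TL n) (Equiv.Perm (Fin n))ᵐᵒᵖ
    ⟨⟨fun w => (f w.unop).unop, by simp⟩, fun a b => by simp⟩, fun i => ?_⟩
  have h := hf i (by omega)
  rw [sw, dif_pos (by omega)] at h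
  simp [perm, adjSwap, h, hm]

/-- The algebra homomorphism `θ : ℂ[𝔖_n] → TL_n(2)` with `θ(s_i) = t_i - 1`
(unique, as the `s_i` generate `𝔖_n`). -/
noncomputable def theta (n : ℕ) : SymAlg n →ₐ[ℂ] TL n := (exists_theta n).choose

theorem theta_adjSwap (n : ℕ) (i : Fin (n - 1)) :
    theta n (perm (adjSwap n i)) = tGen n i - 1 := (exists_theta n).choose_spec i


section Join
variable {α : Type*} [DecidableEq α]
/-- The matching obtained from a matching `f` by joining `a` to `b`, and the former partners of `a`
and `b` to each other (nothing changes if `a` and `b` are already joined). -/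
def joinMate (f : α → α) (a b u : α) : α :=
  if u = a then b else if u = b then a else
  if u = f a then f b else if u = f b then f a else f u

theorem joinMate_idem {f : α → α} {a b : α} (hab : a ≠ b) (h : ∀ u, f (f u) = u) :
   joinMate (joinMate f a b) a b = joinMate f a b := by
  funext u
  have h1 : joinMate f a b a = b := by simp [joinMate]
  have h2 : joinMate f a b b = a := by simp [joinMate, hab.symm]
  rw [joinMate, h1, h2]
  grind [joinMate]

theorem joinMate_adjacent {f : α → α} {a b c : α} (hab : a ≠ b) (hbc : b ≠ c) (hac : a ≠ c)
    (h : ∀ u, f (f u) = u) (h' : ∀ u, f u ≠ u) (hf : f a = b) :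
   joinMate (joinMate f b c) a b = f := by
  funext u
  have hb : f b = a := by rw [← hf, h]
  have h1 : joinMate f b c b = c := by simp [joinMate]
  have h2 : joinMate f b c a = f c := by simp [joinMate, hab, hac, hb]
  have hca : f c ≠ a := by grind
  have hcb : f c ≠ b := by grind
  rw [joinMate, h1, h2]
  unfold joinMate
  have := h u
  have := h c
  have := h' c
  grind

theorem joinMate_comm {f : α → α} {a b : α} (hab : a ≠ b) (h : ∀ u, f (f u) = u)
    (h' : ∀ u, f u ≠ u) :
   joinMate f b a = joinMate f a b := by
  funext u
  unfold joinMate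
  grind

theorem joinMate_distant {f : α → α} {a b c d: α} (hab : a ≠ b) (hcd : c ≠ d) (hac : a ≠ c) (had : a ≠ d)
    (hbc : b ≠ c) (hbd : b ≠ d) (h : ∀ u, f (f u) = u) (h' : ∀ u, f u ≠ u) :
   joinMate (joinMate f c d) a b = joinMate (joinMate f a b) c d := by
  funext u
  have ha := h a
  have hb := h b
  have hc := h c
  have hd := h d
  have hu := h u
  have ha' := h' a
  have hb' := h' b
  have hc' := h' c
  have hd' := h' d
  have hu' := h' u
  have e1 : joinMate f c d a = if a = f c then f d else if a = f d then f c else f a := by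
    simp [joinMate, hac, had]
  have e2 : joinMate f c d b = if b = f c then f d else if b = f d then f c else f b := by
    simp [joinMate, hbc, hbd]
  have e3 : joinMate f a b c = if c = f a then f b else if c = f b then f a else f c := by
    simp [joinMate, hac.symm, hbc.symm]
  have e4 : joinMate f a b d = if d = f a then f b else if d = f b then f a else f d := by
    simp [joinMate, had.symm, hbd.symm]
  rw [joinMate.eq_1 (joinMate f c d), joinMate.eq_1 (joinMate f a b), e1, e2, e3, e4]
  unfold joinMate
  clear e1 e2 e3 e4 h h'
  by_cases h1 : f a = c <;> by_cases h2 : f a = d <;> by_cases h3 : f b = c <;>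
    by_cases h4 : f b = d <;> grind (splits := 30)

theorem joinMate_closes {f : α → α} {a b c d : α} (hab : a ≠ b) (hcd : c ≠ d) (hac : a ≠ c)
    (had : a ≠ d) (hbc : b ≠ c) (hbd : b ≠ d) (h : ∀ u, f (f u) = u) (h' : ∀ u, f u ≠ u) :
    joinMate f c d a = b ↔ f a = b ∨ (f a = c ∧ f b = d) ∨ (f a = d ∧ f b = c) := by
  have ha := h a
  have hb := h b
  have hc := h c
  have hd := h d
  have ha' := h' a
  have hb' := h' b
  have e1 : joinMate f c d a = if a = f c then f d else if a = f d then f c else f a := by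
    simp [joinMate, hac, had]
  rw [e1]
  clear e1 h h'
  grind

theorem joinMate_noncrossing {f : α → α} {a b : α} (hab : a ≠ b) (pos : α → ℕ)
    (hp : pos b = pos a + 1) (hi : Function.Injective pos) (h : ∀ u, f (f u) = u)
    (h' : ∀ u, f u ≠ u)
    (nc : ∀ u v, ¬ (pos u < pos v ∧ pos v < pos (f u) ∧ pos (f u) < pos (f v)))
    (u v : α) :
  ¬ (pos u < pos v ∧ pos v < pos (joinMate f a b u) ∧ pos (joinMate f a b u) < pos (joinMate f a b v)) := by
  have hne : ∀ x y, x ≠ y → pos x ≠ pos y := fun x y h e => h (hi e)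
  have hne' : ∀ x y, x = y → pos x = pos y := fun x y h => h ▸ rfl
  by_cases hl : f a = b
  · have : f b = a := by rw [← hl, h]
    have : joinMate f a b = f := by funext u; unfold joinMate; grind
    rw [this]; exact nc u v
  have hl' : f b ≠ a := by grind
  intro hc
  have H1 := nc u v
  have X := h a
  have Y := h b
  have U := h u
  have V := h v
  simp only [joinMate] at hc
  have n1 := nc a u
  have n2 := nc a v
  have n3 := nc b u
  have n4 := nc b v
  have n5 := nc (f a) u
  have n6 := nc (f a) v
  have n7 := nc (f b) u
  have n8 := nc (f b) v
  have m1 := nc u a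
  have m2 := nc v a
  have m3 := nc u b
  have m4 := nc v b
  have m5 := nc u (f a) 
  have m6 := nc v (f a)
  have m7 := nc u (f b)
  have m8 := nc v (f b)
  have l1 := nc a b
  have l2 := nc b a
  have l3 := nc a (f b)
  have l4 := nc b (f a)
  have l5 := nc (f a) b
  have l6 := nc (f b) a
  have l7 := nc (f a) (f b)
  have l8 := nc (f b) (f a)
  have k1 := hne a u
  have k2 := hne a v
  have k3 := hne b u
  have k4 := hne b v
  have k5 := hne (f a) u
  have k6 := hne (f a) v
  have k7 := hne (f b) u
  have k8 := hne (f b) v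
  have q1 := hne (f u) a
  have q2 := hne (f v) a
  have q3 := hne (f u) b
  have q4 := hne (f v) b
  have q5 := hne _ _ (h' a)
  have q6 := hne _ _ (h' b)
  have q7 := hne _ _ hl
  have q8 := hne _ _ hl'
  rw [X] at *
  rw [Y] at *
  split_ifs at hc <;> (try subst_vars) <;> (try simp only [X, Y, U, V] at *) <;> grind

end Join

/-! ### Kauffman diagrams -/

/-- The `2n` vertices of a Kauffman diagram: `inl i` is the left point `A_i`, `inr i` is the right
point `B_i`. -/
abbrev Vert (n : ℕ) : Type := Fin n ⊕ Fin n

/-- The position of a vertex on the boundary of the rectangle, in the cyclic order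
`A_1, …, A_n, B_n, …, B_1`. -/
def pos {n : ℕ} : Vert n → ℕ
  | .inl i => i
  | .inr i => 2 * n - 1 - i

theorem pos_injective {n : ℕ} : Function.Injective (pos (n := n)) := by
  rintro (i | i) (j | j) h <;> simp only [pos] at h
  · exact congrArg _ (Fin.ext h)
  · omega
  · omega
  · exact congrArg _ (Fin.ext (by omega))

/-- A Kauffman diagram: a perfect matching of the `2n` boundary points by pairwise nonintersecting
edges inside the rectangle. -/
@[ext]
structure KauffmanDiagram (n : ℕ) where
  mate : Vert n → Vert n
  mate_mate : ∀ u, mate (mate u) = u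
  mate_ne : ∀ u, mate u ≠ u
  noncrossing : ∀ u v,
    ¬ (pos u < pos v ∧ pos v < pos (mate u) ∧ pos (mate u) < pos (mate v))

namespace KauffmanDiagram

/-- The diagram in which all edges go horizontally from left to right. -/
def one (n : ℕ) : KauffmanDiagram n where
  mate := Sum.swap
  mate_mate := Sum.swap_swap
  mate_ne := by rintro (i | i) <;> simp
  noncrossing := by
    rintro (i | i) (j | j) <;> simp only [pos, Sum.swap_inl, Sum.swap_inr] <;> omega

variable {n : ℕ}

/-- The left point `A_i`. -/
def low (i : Fin (n - 1)) : Vert n := .inl ⟨i, by omega⟩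

/-- The left point `A_{i+1}`. -/
def high (i : Fin (n - 1)) : Vert n := .inl ⟨i + 1, by omega⟩

theorem pos_high (i : Fin (n - 1)) : pos (high i) = pos (low i) + 1 := rfl

theorem low_ne_high (i : Fin (n - 1)) : low i ≠ high i := by
  simp [low, high]

/-- The diagram (closed loops removed) of the concatenation of the diagram of `t_i` (on the left)
and of `D` (on the right). -/
def cap (i : Fin (n - 1)) (D : KauffmanDiagram n) : KauffmanDiagram n where
  mate := joinMate D.mate (low i) (high i)
  mate_mate u := by
    have h := D.mate_mate
    have h' := D.mate_ne
    have := low_ne_high i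
    unfold joinMate
    grind
  mate_ne u := by
    have h := D.mate_mate
    have h' := D.mate_ne
    have := low_ne_high i
    unfold joinMate
    grind
  noncrossing := joinMate_noncrossing (low_ne_high i) pos (pos_high i) pos_injective
    D.mate_mate D.mate_ne D.noncrossing

/-- The scalar from closed loops in the concatenation of `t_i` and `D`: there is at most one loop,
closed by the edge of `D` from `A_i` to `A_{i+1}`, if present. -/
noncomputable def loopFactor (i : Fin (n - 1)) (D : KauffmanDiagram n) : ℂ :=
  if D.mate (low i) = high i then 2 else 1

/-- Left multiplication by (the diagram of) `t_i` on the vector space spanned by the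
Kauffman diagrams. -/
noncomputable def tOp (i : Fin (n - 1)) : Module.End ℂ (KauffmanDiagram n →₀ ℂ) :=
  Finsupp.linearCombination ℂ fun D => Finsupp.single (cap i D) (loopFactor i D)

theorem tOp_single (i : Fin (n - 1)) (D : KauffmanDiagram n) (c : ℂ) :
    tOp i (Finsupp.single D c) = Finsupp.single (cap i D) (c * loopFactor i D) := by
  simp [tOp]

theorem tOp_sq (i : Fin (n - 1)) : tOp i * tOp i = (2 : ℂ) • tOp (n := n) i := by
  refine Finsupp.lhom_ext fun D c => ?_
  have h1 : cap i (cap i D) = cap i D :=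
    KauffmanDiagram.ext (joinMate_idem (low_ne_high i) D.mate_mate)
  have h2 : loopFactor i (cap i D) = 2 := by simp [loopFactor, cap, joinMate]
  simp only [Module.End.mul_apply, tOp_single, LinearMap.smul_apply, h1, h2, Finsupp.smul_single,
    smul_eq_mul]
  congr 1
  ring

theorem cap_adjacent (i j : Fin (n - 1)) (hij : (i : ℕ) + 1 = j ∨ (j : ℕ) + 1 = i)
    (D : KauffmanDiagram n) (hD : D.mate (low i) = high i) :
    cap i (cap j D) = D ∧ loopFactor j D = 1 ∧ loopFactor i (cap j D) = 1 := by
  have hi := low_ne_high i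
  have hj := low_ne_high j
  have hD' : D.mate (high i) = low i := by rw [← hD, D.mate_mate]
  rcases hij with h | h
  · have e : low j = high i := by simp [low, high, h]
    have hac : low i ≠ high j := by simp [low, high]; omega
    rw [e] at hj
    refine ⟨KauffmanDiagram.ext ?_, ?_, ?_⟩
    · change joinMate (joinMate D.mate (low j) (high j)) (low i) (high i) = D.mate
      rw [e]
      exact joinMate_adjacent hi hj hac D.mate_mate D.mate_ne hD
    · rw [loopFactor, e, hD', if_neg hac]
    · have : (cap j D).mate (low i) = D.mate (high j) := by
        change joinMate D.mate (low j) (high j) (low i) = _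
        simp [joinMate, e, hi, hac, hD']
      rw [loopFactor, this, if_neg]
      intro h
      apply hac
      rw [← hD', ← h, D.mate_mate]
  · have e : high j = low i := by simp [low, high, h]
    have hac : high i ≠ low j := by simp [low, high]; omega
    rw [e] at hj
    have hs := joinMate_comm (f := D.mate) hj D.mate_mate D.mate_ne
    have hm : (cap j D).mate = joinMate D.mate (low i) (low j) := by
      change joinMate D.mate (low j) (high j) = _
      rw [e, hs]
    have hA := joinMate_adjacent hi.symm hj.symm hac D.mate_mate D.mate_ne hD'
    refine ⟨KauffmanDiagram.ext ?_, ?_, ?_⟩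
    · change joinMate (cap j D).mate (low i) (high i) = D.mate
      rw [← joinMate_comm hi (cap j D).mate_mate (cap j D).mate_ne, hm]
      exact hA
    · rw [loopFactor, e, if_neg]
      intro h
      apply hac
      rw [← hD, ← h, D.mate_mate]
    · have : (cap j D).mate (low i) = low j := by
        rw [hm]; simp [joinMate]
      rw [loopFactor, this, if_neg hac.symm]

theorem tOp_adjacent (i j : Fin (n - 1)) (hij : (i : ℕ) + 1 = j ∨ (j : ℕ) + 1 = i) :
    tOp i * tOp j * tOp i = tOp (n := n) i := by
  refine Finsupp.lhom_ext fun D c => ?_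
  have h : (cap i D).mate (low i) = high i := by simp [cap, joinMate]
  obtain ⟨h1, h2, h3⟩ := cap_adjacent i j hij (cap i D) h
  simp only [Module.End.mul_apply, tOp_single, h1, h2, h3, mul_one]

theorem tOp_distant (i j : Fin (n - 1)) (hij : (i : ℕ) + 2 ≤ j ∨ (j : ℕ) + 2 ≤ i) :
    tOp i * tOp j = tOp j * tOp (n := n) i := by
  refine Finsupp.lhom_ext fun D c => ?_
  have h1 := low_ne_high i
  have h2 := low_ne_high j
  have h3 : low i ≠ low j ∧ low i ≠ high j ∧ high i ≠ low j ∧ high i ≠ high j := by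
    simp [low, high]; omega
  obtain ⟨ha, hb, hc, hd⟩ := h3
  have e : cap i (cap j D) = cap j (cap i D) :=
    KauffmanDiagram.ext (joinMate_distant h1 h2 ha hb hc hd D.mate_mate D.mate_ne)
  have f1 := joinMate_closes h1 h2 ha hb hc hd D.mate_mate D.mate_ne
  have f2 := joinMate_closes h2 h1 ha.symm hc.symm hb.symm hd.symm D.mate_mate D.mate_ne
  change (cap j D).mate _ = _ ↔ _ at f1
  change (cap i D).mate _ = _ ↔ _ at f2
  simp only [Module.End.mul_apply, tOp_single, e, loopFactor, f1, f2]
  congr 1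
  have h := D.mate_mate
  have h' := D.mate_ne
  rw [mul_assoc, mul_assoc]
  congr 1
  by_cases p : D.mate (low i) = high i <;> by_cases q : D.mate (low j) = high j <;> grind

end KauffmanDiagram

/-- The action of `TL_n(2)` on the span of the Kauffman diagrams by concatenation: every `t_i` acts
by left multiplication with its diagram. -/
noncomputable def diagramAction (n : ℕ) : TL n →ₐ[ℂ] Module.End ℂ (KauffmanDiagram n →₀ ℂ) :=
  RingQuot.liftAlgHom ℂ ⟨FreeAlgebra.lift ℂ KauffmanDiagram.tOp, by
    rintro _ _ (i | ⟨i, j, h⟩ | ⟨i, j, h⟩)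
    · simp [KauffmanDiagram.tOp_sq]
    · simp [KauffmanDiagram.tOp_adjacent i j h]
    · simp [KauffmanDiagram.tOp_distant i j h]⟩

theorem diagramAction_tGen (n : ℕ) (i : Fin (n - 1)) :
    diagramAction n (tGen n i) = KauffmanDiagram.tOp i := by
  simp [diagramAction, tGen]

/-- The expansion of an element of `TL_n(2)` in the basis of Kauffman diagrams, a product of
generators being the concatenation of their diagrams. -/
noncomputable def expand {n : ℕ} (a : TL n) : KauffmanDiagram n →₀ ℂ :=
  diagramAction n a (Finsupp.single (KauffmanDiagram.one n) 1)

/-- `f_τ(w)`, the coefficient of `τ` in `θ(w)`. -/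
noncomputable def fTau {n : ℕ} (τ : KauffmanDiagram n) (w : Equiv.Perm (Fin n)) : ℂ :=
  expand (theta n (perm w)) τ

/-- `B(I)`, the product of the `1 + s_i` over `i ∈ I`, in increasing order from left to right. -/
noncomputable def prodB {n : ℕ} (I : Finset (Fin (n - 1))) : SymAlg n :=
  ((I.sort (· ≤ ·)).map fun i => 1 + perm (adjSwap n i)).prod

/-- `τ = τ(I)`, where `τ(I) = θ(B(I))` is the product of the `t_i` over `i ∈ I`, in increasing
order. -/
def IsTauOf {n : ℕ} (τ : KauffmanDiagram n) (I : Finset (Fin (n - 1))) : Prop :=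
  expand (theta n (prodB I)) = Finsupp.single τ 1

/-! ### Lattice paths and networks -/

/-- The edges of the lattice above height `0`: `south a b` is the step `(a, b+1) → (a, b)` and
`southwest a b` is the step `(a, b+1) → (a-1, b)`. -/
inductive Edge
  | south (a : ℤ) (b : ℕ)
  | southwest (a : ℤ) (b : ℕ)

/-- The weight of an edge: the variable `x_{b+1}` for a southwest step starting at height `b+1`, and
`1` for a south step. The variables `x_1, x_2, …` are indexed by `ℕ`, `X b` standing for `x_{b+1}`. -/
noncomputable def Edge.weight : Edge → MvPowerSeries ℕ ℂ
  | .south _ _ => 1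
  | .southwest _ b => MvPowerSeries.X b

/-- A south-southwest lattice path from `(A, ∞)` to `(B, 0)`. Every step goes down by one, so the
path visits exactly one point `(x b, b)` at each height `b`; far up, the path is vertical. -/
structure LatticePath (A B : ℤ) where
  x : ℕ → ℤ
  finish : x 0 = B
  step : ∀ b, x (b + 1) = x b ∨ x (b + 1) = x b + 1
  start : ∃ N, ∀ b, N ≤ b → x b = A

/-- The edge `e` is a step of the path `p`. -/
def LatticePath.Uses {A B : ℤ} (p : LatticePath A B) : Edge → Prop
  | .south a b => p.x (b + 1) = a ∧ p.x b = a
  | .southwest a b => p.x (b + 1) = a ∧ p.x b = a - 1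

/-- The abscissa `λ_i + n - i` of `A(λ)_i` (and of `B(λ)_i`); rows are numbered from `0` here. -/
def abscissa (n : ℕ) (lam : YoungDiagram) (i : Fin n) : ℤ :=
  (lam.rowLen i : ℤ) + n - 1 - (i : ℕ)

/-- A `(λ, μ)`-path family: `n` lattice paths `p_i : A(λ)_i → B(μ)_{σ(i)}`, together with its
type `σ`. -/
structure PathFamily (n : ℕ) (lam mu : YoungDiagram) where
  type : Equiv.Perm (Fin n)
  path : ∀ i, LatticePath (abscissa n lam i) (abscissa n mu (type i))

/-- The multiset of edges covered by a path family: the multiplicity of an edge is the number of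
paths using it. -/
noncomputable def PathFamily.edges {n : ℕ} {lam mu : YoungDiagram} (p : PathFamily n lam mu) :
    Edge → ℕ :=
  fun e => Nat.card {i // (p.path i).Uses e}

/-- A `(λ, μ)`-subnetwork: a multiset of edges, given by multiplicities, that is the disjoint union
of the paths of some `(λ, μ)`-path family. -/
def Subnetwork (n : ℕ) (lam mu : YoungDiagram) : Type :=
  {H : Edge → ℕ // ∃ p : PathFamily n lam mu, p.edges = H}

namespace Subnetwork
variable {n : ℕ} {lam mu : YoungDiagram}

/-- The path family `p` covers `H`. -/
def CoveredBy (H : Subnetwork n lam mu) (p : PathFamily n lam mu) : Prop := p.edges = H.1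

theorem exists_bound (H : Subnetwork n lam mu) : ∃ N : ℕ,
    (∀ a b, H.1 (.southwest a b) ≠ 0 → b < N) ∧ (∀ p, H.CoveredBy p → ∀ i b, N ≤ b →
      (p.path i).x b = abscissa n lam i) := by
  obtain ⟨H, q, rfl⟩ := H
  choose N hN using fun i => (q.path i).start
  have key : ∀ a b, q.edges (.southwest a b) ≠ 0 → b < Finset.univ.sup N := by
    intro a b h
    obtain ⟨⟨i, hi⟩⟩ := (Nat.card_ne_zero.1 h).1
    by_contra hb
    have hle : N i ≤ b := (Finset.le_sup (Finset.mem_univ i)).trans (not_lt.1 hb)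
    have h1 := hN i b hle
    have h2 := hN i (b + 1) (by omega)
    simp only [LatticePath.Uses] at hi
    omega
  refine ⟨_, key, fun p hp i b hb => ?_⟩
  have hst : ∀ b, Finset.univ.sup N ≤ b → (p.path i).x (b + 1) = (p.path i).x b := by
    intro b hb
    rcases (p.path i).step b with h | h
    · exact h
    · exfalso
      have hu : (p.path i).Uses (.southwest ((p.path i).x (b + 1)) b) := ⟨rfl, by omega⟩
      have hne : p.edges (.southwest ((p.path i).x (b + 1)) b) ≠ 0 :=
        Nat.card_ne_zero.2 ⟨⟨⟨i, hu⟩⟩, inferInstance⟩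
      have := key _ b (by rwa [show p.edges = q.edges from hp] at hne)
      omega
  obtain ⟨M, hM⟩ := (p.path i).start
  have hc : ∀ d, (p.path i).x (b + d) = (p.path i).x b := by
    intro d
    induction d with
    | zero => rfl
    | succ d ih => rw [← add_assoc, hst _ (by omega), ih]
  rw [← hc M, hM _ (by omega)]

theorem path_bounds {A B : ℤ} (p : LatticePath A B) (b : ℕ) : B ≤ p.x b ∧ p.x b ≤ B + b := by
  induction b with
  | zero => simp [p.finish]
  | succ b ih => rcases p.step b with h | h <;> push_cast <;> omega

/-- A subnetwork is covered by finitely many path families only. -/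
theorem finite_covers (H : Subnetwork n lam mu) : {p | H.CoveredBy p}.Finite := by
  obtain ⟨N, -, hN⟩ := H.exists_bound
  let F : {p | H.CoveredBy p} → (Σ σ : Equiv.Perm (Fin n), ∀ (i : Fin n) (b : Fin N),
      Set.Icc (abscissa n mu (σ i)) (abscissa n mu (σ i) + (b : ℕ))) := fun p =>
    ⟨p.1.type, fun i b => ⟨(p.1.path i).x b, path_bounds _ _⟩⟩
  have hF : Function.Injective F := by
    rintro ⟨⟨σ, p⟩, hp⟩ ⟨⟨τ, q⟩, hq⟩ h
    obtain rfl : σ = τ := congrArg Sigma.fst h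
    have h2 := eq_of_heq (Sigma.mk.inj h).2
    have : p = q := by
      funext i
      have hx : (p i).x = (q i).x := by
        funext b
        by_cases hb : b < N
        · exact congrArg Subtype.val (congrFun (congrFun h2 i) ⟨b, hb⟩)
        · rw [hN _ hp i b (not_lt.1 hb), hN _ hq i b (not_lt.1 hb)]
      cases hpi : p i
      cases hqi : q i
      simp only [hpi, hqi] at hx
      subst hx
      rfl
    subst this
    rfl
  have := Finite.of_injective F hF
  exact Set.toFinite _

/-- The path family generating function `β(H)`, the sum of the types of the path families covering
`H`, grouped by type. -/
noncomputable def beta (H : Subnetwork n lam mu) : SymAlg n :=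
  ∑ σ, (Nat.card {p // H.CoveredBy p ∧ p.type = σ} : ℂ) • perm σ

/-- `ε(H)`, the unique exponent with `θ(β(H)) = 2 ^ ε(H) ψ` for a Kauffman diagram `ψ`. -/
noncomputable def eps (H : Subnetwork n lam mu) : ℕ :=
  sInf {e | ∃ ψ : KauffmanDiagram n, expand (theta n H.beta) = Finsupp.single ψ ((2 : ℂ) ^ e)}

/-- The weight of `H`: the product of the weights of its edges with multiplicity, which is the
weight of any path family covering `H`. Only finitely many factors differ from `1`. -/
noncomputable def wt (H : Subnetwork n lam mu) : MvPowerSeries ℕ ℂ :=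
  ∏ᶠ e : Edge, e.weight ^ H.1 e

end Subnetwork

/-! ### Multinetworks -/

/-- A multinetwork is a tuple of subnetworks. -/
def Multinetwork (n : ℕ) {k : ℕ} (lam mu : Fin k → YoungDiagram) : Type :=
  ∀ r, Subnetwork n (lam r) (mu r)

/-- A power series in `x_1, x_2, …`, written in the `r`-th sequence of variables `x^{(r)}`. -/
noncomputable def inVars {k : ℕ} (r : Fin k) :
    MvPowerSeries ℕ ℂ →ₐ[ℂ] MvPowerSeries (Fin k × ℕ) ℂ :=
  MvPowerSeries.rename (Function.Embedding.sectR r ℕ)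

namespace Multinetwork
variable {n k : ℕ} {lam mu : Fin k → YoungDiagram}

/-- The path family generating function: the sum of the shared types of all tuples of path families
of the same type covering `H` componentwise, grouped by type. -/
noncomputable def beta (H : Multinetwork n lam mu) : SymAlg n :=
  ∑ σ, (Nat.card {p : ∀ r, PathFamily n (lam r) (mu r) //
    ∀ r, (H r).CoveredBy (p r) ∧ (p r).type = σ} : ℂ) • perm σ

noncomputable def eps (H : Multinetwork n lam mu) : ℕ := ∑ r, (H r).eps

noncomputable def wt (H : Multinetwork n lam mu) : MvPowerSeries (Fin k × ℕ) ℂ :=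
  ∏ r, inVars r (H r).wt

end Multinetwork

/-! ### Symmetric functions, Jacobi-Trudi matrices and immanants -/

open Classical in
/-- The elementary symmetric function `e_d` in infinitely many variables, for `d : ℤ`. -/
noncomputable def elemSym (d : ℤ) : MvPowerSeries ℕ ℂ :=
  fun m => if (∀ b, m b ≤ 1) ∧ (m.degree : ℤ) = d then 1 else 0

/-- The monomial symmetric function `m_λ` in infinitely many variables. -/
noncomputable def monoSym (lam : YoungDiagram) : MvPowerSeries ℕ ℂ :=
  fun m => if m.support.val.map m = (lam.rowLens : Multiset ℕ) then 1 else 0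

/-- The `n × n` matrix with entries `e_{λ_i - μ_j - i + j}`. -/
noncomputable def jacobiTrudi (n : ℕ) (lam mu : YoungDiagram) :
    Matrix (Fin n) (Fin n) (MvPowerSeries ℕ ℂ) :=
  Matrix.of fun i j => elemSym ((lam.rowLen i : ℤ) - mu.rowLen j - (i : ℕ) + (j : ℕ))

/-- The Hadamard product of the Jacobi-Trudi matrices of `λ^{(r)}/μ^{(r)}`, the `r`-th of them in
the variables `x^{(r)}`. -/
noncomputable def hadamardJT (n : ℕ) {k : ℕ} (lam mu : Fin k → YoungDiagram) :
    Matrix (Fin n) (Fin n) (MvPowerSeries (Fin k × ℕ) ℂ) :=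
  Matrix.of fun i j => ∏ r, inVars r (jacobiTrudi n (lam r) (mu r) i j)

/-- The `f`-immanant of a matrix. -/
noncomputable def imm {n : ℕ} {R : Type*} [CommRing R] [Algebra ℂ R]
    (f : Equiv.Perm (Fin n) → ℂ) (A : Matrix (Fin n) (Fin n) R) : R :=
  ∑ w, f w • ∏ i, A i (w i)

/-- The product `m_{λ^{(1)}}(x^{(1)}) ⋯ m_{λ^{(k)}}(x^{(k)})`. -/
noncomputable def multiMonoSym {k : ℕ} (nu : Fin k → YoungDiagram) :
    MvPowerSeries (Fin k × ℕ) ℂ :=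
  ∏ r, inVars r (monoSym (nu r))

/-- `F` is a (finite) linear combination, with nonnegative real coefficients, of products of
monomial symmetric functions. -/
def IsMonomialPositive {k : ℕ} (F : MvPowerSeries (Fin k × ℕ) ℂ) : Prop :=
  ∃ c : (Fin k → YoungDiagram) →₀ ℝ, (∀ nu, 0 ≤ c nu) ∧
    F = c.sum fun nu a => (a : ℂ) • multiMonoSym nu

/-- `F` is a (finite) linear combination, with nonnegative integer coefficients, of products of
monomial symmetric functions. -/
def IsIntegrallyMonomialPositive {k : ℕ} (F : MvPowerSeries (Fin k × ℕ) ℂ) : Prop :=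
  ∃ c : (Fin k → YoungDiagram) →₀ ℕ, F = c.sum fun nu a => (a : ℂ) • multiMonoSym nu

/-- The skew shape `λ/μ` does not contain a block of cells with three rows and two columns. -/
def Avoids32 (lam mu : YoungDiagram) : Prop :=
  ¬ ∃ i j, ∀ a b, a < 3 → b < 2 → (i + a, j + b) ∈ lam ∧ (i + a, j + b) ∉ mu

end TLImm

open TLImm
open scoped MvPowerSeries.WithPiTopology

namespace TLImm

/-! ### The group algebra elements `B(I)` -/

/-! Extracting coefficients turns the immanant into a count of paths. A product of elementary
symmetric functions counts path families of a fixed type. Grouping the families by the edges they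
cover shows that the coefficient of a monomial in `imm f M` is the sum, over the multinetworks of
that weight, of `f` extended linearly and applied to `β` (`Multinetwork.coeff_imm`). So everything
rests on `β` being a power of two times some `B(I)`.

For one component, let `q` be the noncrossing family with the same edges. Avoiding a 3 × 2 block
forces `λ_{i+2} ≤ μ_i + 1`, so paths whose indices differ by at least two occupy disjoint ranges of
abscissas and only neighbours touch (`Avoids32.abscissa_lt`). Whenever the paths `j` and `j + 1`
part on the way down, their lower ends may be exchanged or not, which contributes a factor `1 +
s_j`. The splits are processed from height 0 upwards, each factor being multiplied on the left.
Every split of `j - 1` and `j` lies higher than every split of `j` and `j + 1`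
(`Noncrossing.isSplit_lt`), so `1 + s_j` never meets a product containing `1 + s_{j-1}`. It moves to
its place in the increasing product, and a repetition yields a factor 2 (`one_add_perm_mul_prodB`).
The outcome is `2^e B(I)` (`Noncrossing.isBForm`).

For tuples, coefficients of `β` multiply. Now `B(I)` has coefficients 0 and 1, and its support is
cut out by one condition independent of `I` and one condition for each `i ∉ I` (`coeff_prodB`).
Hence the entrywise product of the `B(I_r)` is `B(⋂ I_r)`, and the exponents of two add up.

Finally `θ(B(I))` is a single diagram from which `I` can be read off (`exists_tau`), so each
multinetwork contributes `2^ε` to exactly one immanant. The coefficients are natural numbers,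
symmetric in each sequence of variables and of bounded degree, whence monomial positivity. The sign
kills every `1 + s_i`, so the determinant retains only `I = ∅`. -/

theorem adjSwap_val {n : ℕ} (i : Fin (n - 1)) (x : Fin n) :
    ((adjSwap n i x : Fin n) : ℕ) =
      if (x : ℕ) = i then (i : ℕ) + 1 else if (x : ℕ) = i + 1 then (i : ℕ) else x := by
  rw [adjSwap, Equiv.swap_apply_def]
  simp only [Fin.ext_iff]
  split_ifs <;> rfl

theorem adjSwap_mul_self {n : ℕ} (i : Fin (n - 1)) : adjSwap n i * adjSwap n i = 1 :=
  Equiv.swap_mul_self _ _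

/-- The product of `SymAlg n` reverses composition in `Equiv.Perm`, so left multiplication by the
involution `s_i` becomes composition with `adjSwap n i` on the right. -/
theorem coeff_one_add_mul {n : ℕ} (i : Fin (n - 1)) (a : SymAlg n) (σ : Equiv.Perm (Fin n)) :
    ((1 + perm (adjSwap n i)) * a).coeff (.op σ) =
      a.coeff (.op σ) + a.coeff (.op (σ * adjSwap n i)) := by
  rw [add_mul, one_mul]
  have : (perm (adjSwap n i) : SymAlg n) = MonoidAlgebra.single (.op (adjSwap n i)) 1 := rfl
  rw [this, MonoidAlgebra.coeff_add, Finsupp.add_apply, MonoidAlgebra.coeff_single_mul_apply,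
    one_mul, ← MulOpposite.op_inv, ← MulOpposite.op_mul]
  rfl

theorem coeff_perm {n : ℕ} (w σ : Equiv.Perm (Fin n)) :
    (perm w : SymAlg n).coeff (.op σ) = if w = σ then 1 else 0 := by
  have : (perm w : SymAlg n) = MonoidAlgebra.single (.op w) 1 := rfl
  simp [this, MonoidAlgebra.coeff_single, Finsupp.single_apply]

theorem coeff_sum_perm {n : ℕ} (c : Equiv.Perm (Fin n) → ℂ) (σ : Equiv.Perm (Fin n)) :
    (∑ w, c w • perm w : SymAlg n).coeff (.op σ) = c σ := by
  simp [MonoidAlgebra.coeff_sum, MonoidAlgebra.coeff_smul, coeff_perm]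

theorem symAlg_ext {n : ℕ} {a b : SymAlg n} (h : ∀ σ, a.coeff (.op σ) = b.coeff (.op σ)) :
    a = b := by
  apply MonoidAlgebra.coeff_injective
  ext x
  exact h x.unop

theorem symAlg_eq_sum {n : ℕ} (a : SymAlg n) : a = ∑ w, a.coeff (.op w) • perm w :=
  symAlg_ext fun σ => by rw [coeff_sum_perm]

theorem prodB_empty {n : ℕ} : prodB (∅ : Finset (Fin (n - 1))) = 1 := by simp [prodB]

theorem prodB_insert {n : ℕ} {a : Fin (n - 1)} {I : Finset (Fin (n - 1))} (h : ∀ i ∈ I, a < i) :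
    prodB (insert a I) = (1 + perm (adjSwap n a)) * prodB I := by
  rw [prodB, Finset.sort_insert (r := (· ≤ ·)) (fun b hb => (h b hb).le)
    (fun ha => lt_irrefl _ (h a ha))]
  simp [prodB]

/-- `σ` moves no point down by more than one, and preserves `{0, …, i}` for all `i ∉ I`. -/
def SplitsOutside {n : ℕ} (I : Finset (Fin (n - 1))) (σ : Equiv.Perm (Fin n)) : Prop :=
  (∀ x : Fin n, (x : ℕ) ≤ σ x + 1) ∧
    ∀ i : Fin (n - 1), i ∉ I → ∀ x : Fin n, (x : ℕ) ≤ i → (σ x : ℕ) ≤ i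

/-- Strong induction: a point sent strictly below itself would share its image with a smaller point
that is already fixed. -/
theorem perm_fixes_of_le {n : ℕ} {σ : Equiv.Perm (Fin n)} {a : ℕ}
    (h : ∀ x : Fin n, (x : ℕ) < a → σ x ≤ x) : ∀ x : Fin n, (x : ℕ) < a → σ x = x := by
  intro x
  induction x using WellFoundedLT.induction with
  | ind x ih =>
    intro hx
    by_contra hne
    have hlt : σ x < x := lt_of_le_of_ne (h x hx) hne
    exact hne (σ.injective (ih _ hlt (lt_trans hlt hx)))

theorem SplitsOutside.fixes {n : ℕ} {I : Finset (Fin (n - 1))} {σ : Equiv.Perm (Fin n)}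
    (hσ : SplitsOutside I σ) {a : ℕ} (h : ∀ i ∈ I, a ≤ (i : ℕ)) (x : Fin n) (hx : (x : ℕ) < a)  :
    σ x = x := by
  refine perm_fixes_of_le (a := a) (fun y hy => ?_) x hx
  by_cases hn : (y : ℕ) < n - 1
  · exact hσ.2 ⟨y, hn⟩ (fun hi => by have := h _ hi; simp only at this; omega) y le_rfl
  -- The last point `n - 1` labels no generator, but it cannot be raised.
  · rw [Fin.le_def]; omega

theorem splitsOutside_empty {n : ℕ} {σ : Equiv.Perm (Fin n)} :
    SplitsOutside ∅ σ ↔ σ = 1 := by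
  constructor
  · intro h
    ext x
    rw [h.fixes (a := n) (by simp) x x.2]; rfl
  · rintro rfl
    exact ⟨fun x => by simp, fun i _ x hx => by simpa using hx⟩

theorem splitsOutside_mono {n : ℕ} {I J : Finset (Fin (n - 1))} (h : I ⊆ J)
    {σ : Equiv.Perm (Fin n)} (hσ : SplitsOutside I σ) : SplitsOutside J σ :=
  ⟨hσ.1, fun i hi => hσ.2 i fun h' => hi (h h')⟩

/-- As `σ` fixes every point up to `a`, the product sends `a + 1` to `a` and `a` to `σ (a + 1) > a`.
The only initial segment newly broken is `{0, …, a}`, which `insert a I` permits. -/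
theorem SplitsOutside.mul_adjSwap {n : ℕ} {a : Fin (n - 1)} {I : Finset (Fin (n - 1))}
    (h : ∀ i ∈ I, a < i) {σ : Equiv.Perm (Fin n)} (hσ : SplitsOutside I σ) :
    SplitsOutside (insert a I) (σ * adjSwap n a) := by
  have hfix := fun x : Fin n => hσ.fixes (a := a + 1) (fun i hi => h i hi) x
  have key : ∀ x : Fin n, ((adjSwap n a x : Fin n) : ℕ) ≤ a →
      ((σ (adjSwap n a x) : Fin n) : ℕ) = (adjSwap n a x : Fin n) := fun x hx => by
    rw [hfix _ (by omega)]
  refine ⟨fun x => ?_, fun i hi x hx => ?_⟩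
  · rw [Equiv.Perm.mul_apply]
    have h1 := hσ.1 (adjSwap n a x)
    have h2 := adjSwap_val a x
    have h3 := key x
    have h4 : (σ (adjSwap n a x) : ℕ) ≤ a → ((adjSwap n a x : Fin n) : ℕ) ≤ a := fun hle => by
      have := σ.injective (hfix _ (show ((σ (adjSwap n a x) : Fin n) : ℕ) < a + 1 by omega))
      rw [this] at hle; exact hle
    split_ifs at h2 <;> omega
  · rw [Equiv.Perm.mul_apply]
    simp only [Finset.mem_insert, not_or] at hi
    have hia : (i : ℕ) ≠ a := fun e => hi.1 (Fin.ext e)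
    have h1 := hσ.2 i hi.2 (adjSwap n a x)
    have h2 := adjSwap_val a x
    apply h1
    split_ifs at h2 <;> omega

/-- The preimage of `a` decides. Points below `a` are fixed and no point drops by more than one, so
the preimage is `a` (left alternative) or `a + 1` (right alternative). -/
theorem splitsOutside_insert {n : ℕ} {a : Fin (n - 1)} {I : Finset (Fin (n - 1))}
    (h : ∀ i ∈ I, a < i) (σ : Equiv.Perm (Fin n)) :
    SplitsOutside (insert a I) σ ↔ SplitsOutside I σ ∨ SplitsOutside I (σ * adjSwap n a) := by
  constructor
  · intro hσ
    have hfix := fun x : Fin n => hσ.fixes (a := a) (fun i hi => by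
      rcases Finset.mem_insert.1 hi with rfl | hi
      · exact le_rfl
      · exact (h i hi).le) x
    have ha : (a : ℕ) < n := by omega
    have hb : (a : ℕ) + 1 < n := by omega
    have hval : ∀ x : Fin n, (x : ℕ) < a → (σ x : ℕ) = x := fun x hx => by rw [hfix x hx]
    obtain ⟨x, hx⟩ := σ.surjective ⟨a, ha⟩
    have hxa : (σ x : ℕ) = a := by rw [hx]
    have h1 := hσ.1 x
    have h2 := hval x
    by_cases he : (x : ℕ) = a
    · left
      refine ⟨hσ.1, fun i hi y hy => ?_⟩
      by_cases hia : i = a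
      · subst hia
        rcases hy.lt_or_eq with hy | hy
        · rw [hval y hy]; omega
        · rw [show y = x from Fin.ext (by omega), hxa]
      · exact hσ.2 i (by simp [hi, hia]) y hy
    · right
      have hx' : (x : ℕ) = a + 1 := by omega
      refine ⟨fun y => ?_, fun i hi y hy => ?_⟩
      · rw [Equiv.Perm.mul_apply]
        have h3 := adjSwap_val a y
        have h4 := hσ.1 (adjSwap n a y)
        have h5 := hval (adjSwap n a y)
        split_ifs at h3 with e1 e2
        · omega
        · have h6 : ¬ (σ (adjSwap n a y) : ℕ) < a := fun e => by
            have h7 := congrArg Fin.val (σ.injective (hfix _ e))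
            omega
          omega
        · omega
      · rw [Equiv.Perm.mul_apply]
        have h3 := adjSwap_val a y
        by_cases hia : i = a
        · subst hia
          by_cases hyi : (y : ℕ) = i
          · rw [if_pos hyi] at h3
            rw [show adjSwap n i y = x from Fin.ext (by omega), hxa]
          · rw [if_neg hyi, if_neg (by omega)] at h3
            rw [show adjSwap n i y = y from Fin.ext h3, hval y (by omega)]
            omega
        · apply hσ.2 i (by simp [hi, hia])
          have : (i : ℕ) ≠ a := fun e => hia (Fin.ext e)
          split_ifs at h3 <;> omega
  · rintro (hσ | hσ)
    · exact splitsOutside_mono (Finset.subset_insert _ _) hσ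
    · have := hσ.mul_adjSwap h
      rwa [mul_assoc, adjSwap_mul_self, mul_one] at this

-- No coefficient exceeds 1 because the two terms of `(1 + s_a) B(I)` have disjoint supports: all
-- permutations in the support of `B(I)` fix `a`, which lies below `I`. This explicit support is
-- what makes entrywise products computable.
open Classical in
theorem coeff_prodB {n : ℕ} (I : Finset (Fin (n - 1))) : ∀ σ : Equiv.Perm (Fin n),
    (prodB I).coeff (.op σ) = if SplitsOutside I σ then 1 else 0 := by
  induction I using Finset.induction_on_min with
  | empty =>
    intro σ
    rw [prodB_empty, splitsOutside_empty, show (1 : SymAlg n) = perm 1 from rfl, coeff_perm]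
    by_cases h : σ = 1 <;> simp [h, eq_comm]
  | insert a I h ih =>
    intro σ
    rw [prodB_insert h, coeff_one_add_mul, ih, ih, splitsOutside_insert h]
    by_cases h1 : SplitsOutside I σ <;> by_cases h2 : SplitsOutside I (σ * adjSwap n a)
    · exfalso
      have f1 := h1.fixes (a := a + 1) (fun i hi => h i hi) ⟨a, by omega⟩ (by simp)
      have f2 := h2.fixes (a := a + 1) (fun i hi => h i hi) ⟨a, by omega⟩ (by simp)
      rw [Equiv.Perm.mul_apply, ← f1] at f2
      have f3 := congrArg Fin.val (σ.injective f2)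
      rw [f1, adjSwap_val] at f3
      simp at f3
    all_goals simp [h1, h2]

/-- The second condition is imposed separately for each `i ∉ I`, so intersecting the sets intersects
the supports. The first condition does not involve `I`; `1 ≤ k` provides an index from which to take
it. -/
theorem splitsOutside_inf {n k : ℕ} (hk : 1 ≤ k) (I : Fin k → Finset (Fin (n - 1)))
    (σ : Equiv.Perm (Fin n)) :
    SplitsOutside (Finset.univ.inf I) σ ↔ ∀ r, SplitsOutside (I r) σ := by
  constructor
  · exact fun h r => splitsOutside_mono (Finset.inf_le (Finset.mem_univ r)) h
  · refine fun h => ⟨(h ⟨0, hk⟩).1, fun i hi => ?_⟩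
    simp only [Finset.mem_inf, Finset.mem_univ, true_imp_iff, not_forall] at hi
    obtain ⟨r, hr⟩ := hi
    exact (h r).2 i hr

/-! ### Multiplying `B(I)` by a further factor `1 + s_j` -/

theorem perm_adjSwap_mul_self {n : ℕ} (i : Fin (n - 1)) :
    (1 + perm (adjSwap n i)) * (1 + perm (adjSwap n i)) =
      (2 : ℂ) • (1 + perm (adjSwap n i) : SymAlg n) := by
  have : perm (adjSwap n i) * perm (adjSwap n i) = (1 : SymAlg n) := by
    rw [perm, ← map_mul, ← MulOpposite.op_mul, adjSwap_mul_self, MulOpposite.op_one, map_one]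
  rw [mul_add, add_mul, add_mul, this, two_smul]
  simp only [one_mul, mul_one]
  abel

theorem one_add_perm_comm {n : ℕ} {i j : Fin (n - 1)} (h : (i : ℕ) + 1 < j) :
    (1 + perm (adjSwap n j)) * (1 + perm (adjSwap n i)) =
      ((1 + perm (adjSwap n i)) * (1 + perm (adjSwap n j)) : SymAlg n) := by
  have hc : adjSwap n i * adjSwap n j = adjSwap n j * adjSwap n i := by
    ext x
    simp only [Equiv.Perm.mul_apply, adjSwap_val]
    split_ifs <;> omega
  have : perm (adjSwap n j) * perm (adjSwap n i) =
      (perm (adjSwap n i) * perm (adjSwap n j) : SymAlg n) := by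
    simp only [perm, ← map_mul, ← MulOpposite.op_mul, hc]
  simp only [mul_add, add_mul, this, one_mul, mul_one]
  abel

/-- As `j - 1` is absent, `1 + s_j` commutes past all smaller factors to its place in the increasing
product. A copy already there is absorbed by `(1 + s_j)² = 2 (1 + s_j)`. -/
theorem one_add_perm_mul_prodB {n : ℕ} {j : Fin (n - 1)} (I : Finset (Fin (n - 1)))
    (hI : ∀ i ∈ I, (i : ℕ) + 1 ≠ j) :
    (1 + perm (adjSwap n j)) * prodB I = (if j ∈ I then 2 else 1 : ℂ) • prodB (insert j I) := by
  induction I using Finset.induction_on_min with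
  | empty => rw [prodB_insert (by simp)]; simp
  | insert a I h ih =>
    have ih := ih fun i hi => hI i (Finset.mem_insert_of_mem hi)
    have haj := hI a (Finset.mem_insert_self _ _)
    rcases lt_trichotomy j a with hlt | rfl | hlt
    · have hj : ∀ i ∈ insert a I, j < i := fun i hi => by
        rcases Finset.mem_insert.1 hi with rfl | hi
        · exact hlt
        · exact hlt.trans (h i hi)
      rw [if_neg (fun hm => lt_irrefl _ (hj j hm)), one_smul, prodB_insert hj]
    · rw [if_pos (Finset.mem_insert_self _ _), Finset.insert_idem, prodB_insert h, ← mul_assoc,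
        perm_adjSwap_mul_self, smul_mul_assoc]
    · have hj : ∀ i ∈ insert j I, a < i := fun i hi => by
        rcases Finset.mem_insert.1 hi with rfl | hi
        · exact hlt
        · exact h i hi
      rw [Finset.insert_comm, prodB_insert hj, prodB_insert h, ← mul_assoc,
        one_add_perm_comm (by have : (a : ℕ) < j := hlt; omega), mul_assoc, ih, mul_smul_comm]
      simp [hlt.ne']

/-! ### The Kauffman diagrams `τ(I)` -/

theorem theta_one_add_adjSwap {n : ℕ} (i : Fin (n - 1)) :
    theta n (1 + perm (adjSwap n i)) = tGen n i := by
  rw [map_add, map_one, theta_adjSwap]; abel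

/-- The row of a vertex. -/
def row {n : ℕ} : Vert n → ℕ
  | .inl i => i
  | .inr i => i

-- The two clauses on edges serve different ends. Horizontality below `I` ensures that prepending a
-- smaller `t_a` closes no loop. The last clause recovers `I` from the diagram: `i ∈ I` exactly when
-- some edge crosses the cut between rows `i` and `i + 1`.
open KauffmanDiagram in
theorem exists_tau {n : ℕ} (I : Finset (Fin (n - 1))) : ∃ D : KauffmanDiagram n,
    expand (theta n (prodB I)) = Finsupp.single D 1 ∧
    (∀ x : Fin n, (∀ i ∈ I, (x : ℕ) < i) → D.mate (.inl x) = .inr x) ∧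
    ∀ i : Fin (n - 1), i ∈ I ↔ ∃ u, row u ≤ i ∧ (i : ℕ) < row (D.mate u) := by
  induction I using Finset.induction_on_min with
  | empty =>
    refine ⟨one n, by simp [prodB_empty, expand], fun x _ => rfl, fun i => ?_⟩
    simp only [Finset.notMem_empty, false_iff, not_exists, not_and, not_lt]
    rintro (x | x) hx <;> exact hx
  | insert a I h ih =>
    obtain ⟨D, hD, hline, hcut⟩ := ih
    have hlow : D.mate (low a) = .inr ⟨a, by omega⟩ := hline ⟨a, by omega⟩ h
    have hlow' : D.mate (.inr ⟨a, by omega⟩) = low a := by rw [← hlow, D.mate_mate]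
    have hloop : loopFactor a D = 1 := by
      rw [loopFactor, hlow, if_neg (by simp [high])]
    have hm : ∀ u, (cap a D).mate u = joinMate D.mate (low a) (high a) u := fun _ => rfl
    have hne := low_ne_high a
    have rl : row (low a) = a := rfl
    have rh : row (high a) = a + 1 := rfl
    refine ⟨cap a D, ?_, fun x hx => ?_, fun i => ⟨fun hi => ?_, ?_⟩⟩
    · rw [prodB_insert h, map_mul, theta_one_add_adjSwap]
      rw [expand] at hD ⊢
      rw [map_mul, diagramAction_tGen, Module.End.mul_apply, hD, tOp_single, hloop, one_mul]
    · have hxa := hx a (Finset.mem_insert_self _ _)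
      have hxm := hline x fun i hi => hx i (Finset.mem_insert_of_mem hi)
      have h1 : (Sum.inl x : Vert n) ≠ low a := by
        intro e; have := congrArg row e; simp only [row, low] at this; omega
      have h2 : (Sum.inl x : Vert n) ≠ high a := by
        intro e; have := congrArg row e; simp only [row, high] at this; omega
      have h3 : (Sum.inl x : Vert n) ≠ D.mate (high a) := by
        intro e
        rw [e, D.mate_mate] at hxm
        simp [high] at hxm
      rw [hm, joinMate, if_neg h1, if_neg h2, hlow, if_neg (by simp), if_neg h3, hxm]
    · rcases Finset.mem_insert.1 hi with rfl | hi
      · exact ⟨low i, le_rfl, by rw [hm]; simp [joinMate, rh]⟩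
      · obtain ⟨u, hu, hu'⟩ := (hcut i).1 hi
        have hai : (a : ℕ) < i := h i hi
        have hra : row (.inr ⟨a, by omega⟩ : Vert n) = a := rfl
        -- In the new diagram the former partner of `high a` is joined to the right point of row
        -- `a`, which therefore takes over a crossing that started at `high a`. All other crossing
        -- edges survive unchanged.
        by_cases e : u = high a
        · subst e
          refine ⟨.inr ⟨a, by omega⟩, hai.le, ?_⟩
          rw [hm, joinMate, if_neg (by simp [low]), if_neg (by simp [high]), hlow, if_pos rfl]
          exact hu'
        · refine ⟨u, hu, ?_⟩
          have e1 : u ≠ low a := by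
            rintro rfl
            rw [hlow, hra] at hu'
            omega
          have e2 : u ≠ D.mate (low a) := by
            rintro rfl
            rw [D.mate_mate, rl] at hu'
            omega
          have e3 : u ≠ D.mate (high a) := by
            rintro rfl
            rw [D.mate_mate, rh] at hu'
            omega
          rwa [hm, joinMate, if_neg e1, if_neg e, if_neg e2, if_neg e3]
    · rintro ⟨u, hu, hu'⟩
      by_contra hi
      simp only [Finset.mem_insert, not_or] at hi
      have hia : (i : ℕ) ≠ a := fun e => hi.1 (Fin.ext e)
      have hno : ∀ v, row v ≤ i → ¬ (i : ℕ) < row (D.mate v) := fun v h1 h2 =>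
        hi.2 ((hcut i).2 ⟨v, h1, h2⟩)
      have hra : row (.inr ⟨a, by omega⟩ : Vert n) = a := rfl
      have n1 := hno (high a)
      have n2 := hno (D.mate (high a))
      have n3 := hno u hu
      rw [D.mate_mate] at n2
      rw [hm, joinMate, hlow] at hu'
      split_ifs at hu' with e1 e2 e3 e4
      · subst e1; omega
      · subst e2; omega
      · subst e3; omega
      · subst e4; omega
      · exact n3 hu'

/-- The Kauffman diagram `τ(I)`. -/
noncomputable def tau {n : ℕ} (I : Finset (Fin (n - 1))) : KauffmanDiagram n :=
  (exists_tau I).choose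

theorem expand_theta_prodB {n : ℕ} (I : Finset (Fin (n - 1))) :
    expand (theta n (prodB I)) = Finsupp.single (tau I) 1 := (exists_tau I).choose_spec.1

theorem tau_injective {n : ℕ} : Function.Injective (tau (n := n)) := by
  intro I J h
  ext i
  rw [(exists_tau I).choose_spec.2.2 i, (exists_tau J).choose_spec.2.2 i]
  change (∃ u, _ ∧ _ < row ((tau I).mate u)) ↔ ∃ u, _ ∧ _ < row ((tau J).mate u)
  rw [h]

theorem isTauOf_iff {n : ℕ} {τ : KauffmanDiagram n} {I : Finset (Fin (n - 1))} :
    IsTauOf τ I ↔ τ = tau I := by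
  rw [IsTauOf, expand_theta_prodB, Finsupp.single_left_inj one_ne_zero, eq_comm]

theorem prodB_injective {n : ℕ} : Function.Injective (prodB (n := n)) := by
  intro I J h
  apply tau_injective
  have := expand_theta_prodB I
  rw [h, expand_theta_prodB, Finsupp.single_left_inj one_ne_zero] at this
  exact this.symm

theorem expand_smul {n : ℕ} (c : ℂ) (a : TL n) : expand (c • a) = c • expand a := by
  simp [expand]

theorem expand_theta_smul_prodB {n : ℕ} (I : Finset (Fin (n - 1))) (c : ℂ) :
    expand (theta n (c • prodB I)) = Finsupp.single (tau I) c := by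
  rw [map_smul, expand_smul, expand_theta_prodB, Finsupp.smul_single, smul_eq_mul, mul_one]

theorem sum_fTau {n : ℕ} (τ : KauffmanDiagram n) (c : Equiv.Perm (Fin n) → ℂ) :
    ∑ w, fTau τ w * c w = expand (theta n (∑ w, c w • perm w)) τ := by
  simp [fTau, expand, map_sum, LinearMap.sum_apply, Finsupp.finsetSum_apply, mul_comm]

/-- The sign, as a linear functional on the group algebra. -/
noncomputable def signHom (n : ℕ) : SymAlg n →ₐ[ℂ] ℂ :=
  MonoidAlgebra.lift ℂ ℂ (Equiv.Perm (Fin n))ᵐᵒᵖ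
    { toFun := fun w => ((Equiv.Perm.sign w.unop : ℤ) : ℂ)
      map_one' := by simp
      map_mul' := fun a b => by simp [mul_comm] }

theorem signHom_perm {n : ℕ} (w : Equiv.Perm (Fin n)) :
    signHom n (perm w) = ((Equiv.Perm.sign w : ℤ) : ℂ) := by
  simp [signHom, perm]

theorem signHom_prodB {n : ℕ} (I : Finset (Fin (n - 1))) :
    signHom n (prodB I) = if I = ∅ then 1 else 0 := by
  induction I using Finset.induction_on_min with
  | empty => simp [prodB_empty]
  | insert a I h ih =>
    rw [prodB_insert h, map_mul, map_add, map_one, signHom_perm, adjSwap,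
      Equiv.Perm.sign_swap (by simp)]
    simp

/-! ### Rearrangements of a noncrossing family of paths -/

/-- A family of `n` paths in which neighbours may touch, but not cross, and all other pairs of paths
have disjoint ranges of abscissas. -/
structure Noncrossing {n : ℕ} (q : ℕ → Fin n → ℤ) : Prop where
  step : ∀ b i, q (b + 1) i = q b i ∨ q (b + 1) i = q b i + 1
  anti : ∀ b, Antitone (q b)
  gap : ∀ b c (i j : Fin n), (i : ℕ) + 2 ≤ j → q b j < q c i
  start_injective : Function.Injective (q 0)

/-- The families `x` and `q` use the same edges. -/
def Rearranges {n : ℕ} (x q : ℕ → Fin n → ℤ) : Prop :=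
  ∀ b, ∃ ρ : Equiv.Perm (Fin n), x (b + 1) = q (b + 1) ∘ ρ ∧ x b = q b ∘ ρ

/-- The rearrangements of `q` that agree with `q` above height `b` and, for the paths from the
`j`-th on, also at height `b`. -/
def partialCovers {n : ℕ} (q : ℕ → Fin n → ℤ) (b j : ℕ) : Set (ℕ → Fin n → ℤ) :=
  {x | Rearranges x q ∧ (∀ c, b < c → x c = q c) ∧ ∀ i : Fin n, j ≤ i → x b i = q b i}

/-- The paths `j` and `j + 1` touch at height `b + 1` but not at height `b`. -/
def IsSplit {n : ℕ} (q : ℕ → Fin n → ℤ) (b : ℕ) (j : Fin (n - 1)) : Prop :=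
  q (b + 1) ⟨j, by omega⟩ = q (b + 1) ⟨j + 1, by omega⟩ ∧
    q b ⟨j, by omega⟩ ≠ q b ⟨j + 1, by omega⟩

/-- Exchange of the paths `j` and `j + 1` from height `b` downwards. -/
def swapBelow {n : ℕ} (b : ℕ) (j : Fin (n - 1)) (x : ℕ → Fin n → ℤ) : ℕ → Fin n → ℤ :=
  fun c => if c ≤ b then x c ∘ adjSwap n j else x c

theorem swapBelow_swapBelow {n : ℕ} (b : ℕ) (j : Fin (n - 1)) (x : ℕ → Fin n → ℤ) :
    swapBelow b j (swapBelow b j x) = x := by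
  funext c i
  have : adjSwap n j (adjSwap n j i) = i := Equiv.swap_apply_self _ _ _
  by_cases h : c ≤ b <;> simp [swapBelow, h, this]

theorem swapBelow_injective {n : ℕ} (b : ℕ) (j : Fin (n - 1)) :
    Function.Injective (swapBelow (n := n) b j) :=
  Function.LeftInverse.injective (swapBelow_swapBelow b j)

theorem comp_adjSwap_eq {n : ℕ} {j : Fin (n - 1)} {f : Fin n → ℤ}
    (h : f ⟨j, by omega⟩ = f ⟨j + 1, by omega⟩) : f ∘ adjSwap n j = f := by
  funext i
  simp only [Function.comp_apply, adjSwap, Equiv.swap_apply_def]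
  split_ifs with h1 h2
  · rw [h1, h]
  · rw [h2, h]
  · rfl

/-- Only the step from height `b + 1` to `b` needs care. There the exchange acts at the lower end
only, which is harmless because the swap fixes the tuple at height `b + 1`. -/
theorem Rearranges.swapBelow {n : ℕ} {x q : ℕ → Fin n → ℤ} (hx : Rearranges x q) {b : ℕ}
    {j : Fin (n - 1)} (hb : x (b + 1) ⟨j, by omega⟩ = x (b + 1) ⟨j + 1, by omega⟩) :
    Rearranges (swapBelow b j x) q := by
  intro c
  obtain ⟨ρ, h1, h2⟩ := hx c
  rcases lt_trichotomy c b with h | rfl | h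
  · refine ⟨ρ * adjSwap n j, ?_, ?_⟩
    · simp only [TLImm.swapBelow, if_pos (show c + 1 ≤ b from h), h1]; rfl
    · simp only [TLImm.swapBelow, if_pos h.le, h2]; rfl
  · refine ⟨ρ * adjSwap n j, ?_, ?_⟩
    · simp only [TLImm.swapBelow, if_neg (show ¬ c + 1 ≤ c by omega)]
      rw [← comp_adjSwap_eq hb, h1]; rfl
    · simp only [TLImm.swapBelow, if_pos le_rfl, h2]; rfl
  · refine ⟨ρ, ?_, ?_⟩
    · simp only [TLImm.swapBelow, if_neg (show ¬ c + 1 ≤ b by omega), h1]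
    · simp only [TLImm.swapBelow, if_neg (show ¬ c ≤ b by omega), h2]

/-! ### Splits and their effect on the generating function -/

section
variable {n : ℕ} {q : ℕ → Fin n → ℤ}

theorem Noncrossing.near (hq : Noncrossing q) {b : ℕ} {i j : Fin n} (h : q b i = q b j) :
    (i : ℕ) ≤ j + 1 := by
  by_contra hn
  exact absurd h (hq.gap b b j i (by omega)).ne

/-- Path `j` never moves right on its way down. It meets path `i` strictly to the right of
everything visited by path `j + 1`, hence higher up than where it meets path `j + 1`. -/
theorem Noncrossing.isSplit_lt (hq : Noncrossing q) {b c : ℕ} {i j : Fin (n - 1)}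
    (hij : (i : ℕ) + 1 = j) (hi : IsSplit q c i) (hj : IsSplit q b j) : b < c := by
  have hmono : ∀ k, Monotone fun b => q b k := fun k => monotone_nat_of_le_succ fun b => by
    rcases hq.step b k with h | h <;> omega
  by_contra hn
  have h1 := hmono ⟨j, by omega⟩ (show c + 1 ≤ b + 1 by omega)
  have h2 := hq.gap (b + 1) (c + 1) ⟨i, by omega⟩ ⟨j + 1, by omega⟩ (by simp; omega)
  have h3 := hi.1
  have h4 := hj.1
  simp only [hij] at h3 h1
  omega

/-- Since `x` and `q` agree at height `b + 1`, the matching permutation `ρ` moves paths only among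
touching ones, so indices change by at most one. If `ρ` sends `j + 1` to `j`, it exchanges the two.
If it sends `j + 1` to `j + 2`, it exchanges those, and agreement at index `j + 2` shows that
nothing has changed. -/
theorem Noncrossing.mem_partialCovers (hq : Noncrossing q) {b : ℕ} {j : Fin (n - 1)}
    {x : ℕ → Fin n → ℤ} (hx : x ∈ partialCovers q b (j + 2)) :
    x b ⟨j + 1, by omega⟩ = q b ⟨j + 1, by omega⟩ ∨ (IsSplit q b j ∧
      x b ⟨j + 1, by omega⟩ = q b ⟨j, by omega⟩ ∧ x b ⟨j, by omega⟩ = q b ⟨j + 1, by omega⟩) := by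
  obtain ⟨hr, habove, hb⟩ := hx
  obtain ⟨ρ, h1, h2⟩ := hr b
  rw [habove _ (Nat.lt_succ_self b)] at h1
  have h1 : ∀ i, q (b + 1) i = q (b + 1) (ρ i) := fun i => congrFun h1 i
  have h2 : ∀ i, x b i = q b (ρ i) := fun i => congrFun h2 i
  have near := fun i => hq.near (h1 i)
  have near' := fun i => hq.near (h1 i).symm
  set i0 : Fin n := ⟨j, by omega⟩ with hi0
  set i1 : Fin n := ⟨j + 1, by omega⟩ with hi1
  have v0 : (i0 : ℕ) = j := rfl
  have v1 : (i1 : ℕ) = j + 1 := rfl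
  have hinj : ∀ i i' : Fin n, (i : ℕ) ≠ i' → (ρ i : ℕ) ≠ ρ i' := fun i i' h e =>
    h (congrArg Fin.val (ρ.injective (Fin.ext e)))
  have n1 := near i1
  have n1' := near' i1
  rcases lt_trichotomy (ρ i1) i1 with h | h | h
  · have e1 : ρ i1 = i0 := Fin.ext (by have : (ρ i1 : ℕ) < i1 := h; omega)
    have e2 : q (b + 1) i1 = q (b + 1) i0 := by rw [h1 i1, e1]
    have e3 : ρ i0 = i1 := by
      have m1 := near i0
      have m2 := near' i0
      have m3 := hq.near (b := b + 1) (i := ρ i0) (j := i1) (by rw [← h1, e2])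
      have m4 := hq.near (b := b + 1) (i := i1) (j := ρ i0) (by rw [← h1, e2])
      have m5 := hinj i0 i1 (by omega)
      rw [e1] at m5
      exact Fin.ext (by omega)
    by_cases hs : q b i0 = q b i1
    · left; rw [h2, e1, hs]
    · right; exact ⟨⟨e2.symm, hs⟩, by rw [h2, e1], by rw [h2, e3]⟩
  · left; rw [h2, h]
  · left
    have hlt : (i1 : ℕ) < ρ i1 := h
    have e1 : (ρ i1 : ℕ) = j + 2 := by omega
    have m1 := near (ρ i1)
    have m2 := hq.near (b := b + 1) (i := ρ (ρ i1)) (j := i1) (by rw [← h1, ← h1])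
    have m5 := hinj (ρ i1) i1 (by omega)
    have e2 : ρ (ρ i1) = i1 := Fin.ext (by omega)
    have := hb (ρ i1) (by omega)
    rw [h2, e2] at this
    rw [h2, this]

theorem partialCovers_mono (q : ℕ → Fin n → ℤ) (b : ℕ) {j j' : ℕ} (h : j ≤ j') :
    partialCovers q b j ⊆ partialCovers q b j' :=
  fun _ hx => ⟨hx.1, hx.2.1, fun i hi => hx.2.2 i (h.trans hi)⟩

theorem mem_partialCovers_succ {b : ℕ} {j : Fin (n - 1)} {x : ℕ → Fin n → ℤ}
    (hx : x ∈ partialCovers q b (j + 2)) (h : x b ⟨j + 1, by omega⟩ = q b ⟨j + 1, by omega⟩) :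
    x ∈ partialCovers q b (j + 1) := by
  refine ⟨hx.1, hx.2.1, fun i hi => ?_⟩
  by_cases he : (i : ℕ) = j + 1
  · rw [show i = ⟨j + 1, by omega⟩ from Fin.ext he, h]
  · exact hx.2.2 i (by omega)

theorem Noncrossing.partialCovers_of_not_isSplit (hq : Noncrossing q) {b : ℕ} {j : Fin (n - 1)}
    (h : ¬ IsSplit q b j) : partialCovers q b (j + 2) = partialCovers q b (j + 1) := by
  refine Set.Subset.antisymm (fun x hx => ?_) (partialCovers_mono q b (by omega))
  rcases hq.mem_partialCovers hx with h' | h'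
  · exact mem_partialCovers_succ hx h'
  · exact absurd h'.1 h

theorem swapBelow_mem_partialCovers {b : ℕ} {j : Fin (n - 1)} {x : ℕ → Fin n → ℤ}
    (h : IsSplit q b j) (hx : x ∈ partialCovers q b (j + 2)) :
    swapBelow b j x ∈ partialCovers q b (j + 2) := by
  refine ⟨hx.1.swapBelow (by rw [hx.2.1 _ (Nat.lt_succ_self b)]; exact h.1), fun c hc => ?_,
    fun i hi => ?_⟩
  · rw [swapBelow, if_neg (by omega), hx.2.1 c hc]
  · have : adjSwap n j i = i := by
      apply Fin.ext
      rw [adjSwap_val, if_neg (by omega), if_neg (by omega)]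
    rw [swapBelow, if_pos le_rfl, Function.comp_apply, this, hx.2.2 i hi]

theorem swapBelow_apply_succ {b : ℕ} {j : Fin (n - 1)} {x : ℕ → Fin n → ℤ} :
    swapBelow b j x b ⟨j + 1, by omega⟩ = x b ⟨j, by omega⟩ := by
  rw [swapBelow, if_pos le_rfl, Function.comp_apply, adjSwap, Equiv.swap_apply_right]

/-- The matching permutation preserves `{j, j + 1}`, because both paths touch at height `b + 1`. It
cannot exchange them, as the family agrees with `q` at index `j + 1` and the split separates the two
values. -/
theorem Noncrossing.apply_of_mem_partialCovers (hq : Noncrossing q) {b : ℕ} {j : Fin (n - 1)}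
    {x : ℕ → Fin n → ℤ} (h : IsSplit q b j) (hx : x ∈ partialCovers q b (j + 1)) :
    x b ⟨j, by omega⟩ = q b ⟨j, by omega⟩ := by
  have hx' := swapBelow_mem_partialCovers h (partialCovers_mono q b (by omega) hx)
  have h1 := hx.2.2 ⟨j + 1, by omega⟩ le_rfl
  rcases hq.mem_partialCovers hx' with h' | h'
  · rw [swapBelow_apply_succ] at h'
    obtain ⟨ρ, h2, h3⟩ := hx.1 b
    rw [hx.2.1 _ (Nat.lt_succ_self b)] at h2
    have h2 : ∀ i, q (b + 1) i = q (b + 1) (ρ i) := fun i => congrFun h2 i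
    have h3 : ∀ i, x b i = q b (ρ i) := fun i => congrFun h3 i
    set i0 : Fin n := ⟨j, by omega⟩ with hi0
    set i1 : Fin n := ⟨j + 1, by omega⟩ with hi1
    have v0 : (i0 : ℕ) = j := rfl
    have v1 : (i1 : ℕ) = j + 1 := rfl
    have hinj : (ρ i0 : ℕ) ≠ ρ i1 := fun e => by
      have := congrArg Fin.val (ρ.injective (Fin.ext e))
      omega
    have m : ∀ i k, q (b + 1) i = q (b + 1) k → (ρ i : ℕ) ≤ k + 1 ∧ (k : ℕ) ≤ ρ i + 1 :=
      fun i k e => ⟨hq.near (by rw [← h2, e]), hq.near (by rw [← h2, e])⟩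
    have hs : q (b + 1) i0 = q (b + 1) i1 := h.1
    have a1 := m i0 i0 rfl
    have a2 := m i0 i1 hs
    have a3 := m i1 i1 rfl
    have a4 := m i1 i0 hs.symm
    by_cases e : ρ i0 = i0
    · rw [h3, e]
    · have e' : (ρ i0 : ℕ) ≠ i0 := fun h => e (Fin.ext h)
      have : ρ i1 = i0 := Fin.ext (by omega)
      rw [h3, this] at h1
      exact absurd h1 h.2
  · rw [swapBelow_apply_succ] at h'
    exact h'.2.1

theorem Noncrossing.mem_partialCovers_of_isSplit (hq : Noncrossing q) {b : ℕ} {j : Fin (n - 1)}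
    (h : IsSplit q b j) (x : ℕ → Fin n → ℤ) : x ∈ partialCovers q b (j + 2) ↔
      x ∈ partialCovers q b (j + 1) ∨ swapBelow b j x ∈ partialCovers q b (j + 1) := by
  constructor
  · intro hx
    rcases hq.mem_partialCovers hx with h' | h'
    · exact Or.inl (mem_partialCovers_succ hx h')
    · exact Or.inr (mem_partialCovers_succ (swapBelow_mem_partialCovers h hx)
        (by rw [swapBelow_apply_succ, h'.2.2]))
  · rintro (hx | hx)
    · exact partialCovers_mono q b (by omega) hx
    · have := swapBelow_mem_partialCovers h (partialCovers_mono q b (by omega) hx)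
      rwa [swapBelow_swapBelow] at this

theorem Noncrossing.not_mem_partialCovers (hq : Noncrossing q) {b : ℕ} {j : Fin (n - 1)}
    (h : IsSplit q b j) {x : ℕ → Fin n → ℤ} (hx : x ∈ partialCovers q b (j + 1)) :
    swapBelow b j x ∉ partialCovers q b (j + 1) := by
  intro hx'
  have := hx'.2.2 ⟨j + 1, by omega⟩ le_rfl
  rw [swapBelow_apply_succ, hq.apply_of_mem_partialCovers h hx] at this
  exact h.2 this

/-- At height `b` the tuples `x b` and `q b` are permutations of each other, so they have equal
sums; agreement in all entries but one forces agreement in that one. -/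
theorem partialCovers_one (q : ℕ → Fin n → ℤ) (b : ℕ) :
    partialCovers q b 1 = partialCovers q b 0 := by
  refine Set.Subset.antisymm (fun x hx => ⟨hx.1, hx.2.1, fun i _ => ?_⟩)
    (partialCovers_mono q b (by omega))
  by_cases hi : 1 ≤ (i : ℕ)
  · exact hx.2.2 i hi
  · obtain ⟨ρ, -, h⟩ := hx.1 b
    have hsum : ∑ k, x b k = ∑ k, q b k := by
      rw [h]; exact Equiv.sum_comp ρ (q b)
    rw [← Finset.add_sum_erase _ _ (Finset.mem_univ i),
      ← Finset.add_sum_erase _ _ (Finset.mem_univ i)] at hsum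
    rw [Finset.sum_congr rfl fun k hk => hx.2.2 k ?_] at hsum
    · exact add_right_cancel hsum
    · have : (k : ℕ) ≠ i := fun e => Finset.ne_of_mem_erase hk (Fin.ext e)
      omega

theorem partialCovers_succ_zero (q : ℕ → Fin n → ℤ) (b : ℕ) :
    partialCovers q (b + 1) 0 = partialCovers q b n := by
  ext x
  refine and_congr_right fun _ => ⟨fun h => ⟨fun c hc => ?_, fun i hi => by omega⟩,
    fun h => ⟨fun c hc => h.1 c (by omega), fun i _ => by rw [h.1 (b + 1) (by omega)]⟩⟩
  rcases Nat.lt_or_ge (b + 1) c with hc' | hc'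
  · exact h.1 c hc'
  · rw [show c = b + 1 by omega]; exact funext fun i => h.2 i (by omega)

/-- The number of elements of type `σ` in a set of rearrangements of `q`. -/
noncomputable def typeCount (q : ℕ → Fin n → ℤ) (C : Set (ℕ → Fin n → ℤ))
    (σ : Equiv.Perm (Fin n)) : ℕ :=
  {x ∈ C | x 0 = q 0 ∘ σ}.ncard

/-- The larger set is the disjoint union of the smaller one and its image under `swapBelow`, which
reaches down to height 0 and so changes the type by `s_j`. The right side matches
`coeff_one_add_mul`. -/
theorem Noncrossing.typeCount_of_isSplit (hq : Noncrossing q) {b : ℕ} {j : Fin (n - 1)}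
    (h : IsSplit q b j) (hf : (partialCovers q b (j + 1)).Finite) (σ : Equiv.Perm (Fin n)) :
    typeCount q (partialCovers q b (j + 2)) σ = typeCount q (partialCovers q b (j + 1)) σ +
      typeCount q (partialCovers q b (j + 1)) (σ * adjSwap n j) := by
  have htype : ∀ x : ℕ → Fin n → ℤ, swapBelow b j x 0 = q 0 ∘ σ ↔
      x 0 = q 0 ∘ (σ * adjSwap n j) := fun x => by
    rw [swapBelow, if_pos (Nat.zero_le _)]
    have hs : ∀ i, adjSwap n j (adjSwap n j i) = i := Equiv.swap_apply_self _ _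
    constructor <;> intro e <;> funext i
    · have := congrFun e (adjSwap n j i)
      simpa [hs] using this
    · simp [e, hs]
  set C := {x ∈ partialCovers q b (j + 1) | x 0 = q 0 ∘ σ} with hC
  set C' := {x ∈ partialCovers q b (j + 1) | x 0 = q 0 ∘ (σ * adjSwap n j)} with hC'
  have hunion : {x ∈ partialCovers q b (j + 2) | x 0 = q 0 ∘ σ} = C ∪ swapBelow b j '' C' := by
    ext x
    simp only [hC, hC', Set.mem_union, Set.mem_image, Set.mem_ofPred_eq,
      hq.mem_partialCovers_of_isSplit h, or_and_right]
    refine or_congr_right ⟨fun hx => ⟨swapBelow b j x, ⟨hx.1, ?_⟩, swapBelow_swapBelow _ _ _⟩, ?_⟩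
    · rw [← htype, swapBelow_swapBelow]; exact hx.2
    · rintro ⟨y, hy, rfl⟩
      rw [swapBelow_swapBelow, htype]
      exact hy
  have hdisj : Disjoint C (swapBelow b j '' C') := by
    rw [Set.disjoint_left]
    rintro x hx ⟨y, hy, rfl⟩
    exact hq.not_mem_partialCovers h hy.1 hx.1
  rw [typeCount, hunion, Set.ncard_union_eq hdisj (hf.subset (Set.sep_subset _ _))
    ((hf.subset (Set.sep_subset _ _)).image _),
    Set.ncard_image_of_injective _ (swapBelow_injective (n := n) b j)]
  rfl

/-- The generating function by type of the given rearrangements of `q` is a power of two times some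
`B(I)`, where `I` consists of splits not above height `b`. -/
def IsBForm (q : ℕ → Fin n → ℤ) (b : ℕ) (C : Set (ℕ → Fin n → ℤ)) : Prop :=
  C.Finite ∧ ∃ (e : ℕ) (I : Finset (Fin (n - 1))),
    (∀ σ, (typeCount q C σ : ℂ) = (((2 : ℂ) ^ e) • prodB I).coeff (.op σ)) ∧
    ∀ i ∈ I, ∃ c ≤ b, IsSplit q c i

theorem Noncrossing.isBForm_zero (hq : Noncrossing q) : IsBForm q 0 (partialCovers q 0 0) := by
  have : partialCovers q 0 0 = {q} := by
    ext x
    simp only [Set.mem_singleton_iff]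
    constructor
    · intro hx
      funext c
      rcases Nat.eq_zero_or_pos c with rfl | hc
      · exact funext fun i => hx.2.2 i (Nat.zero_le _)
      · exact hx.2.1 c hc
    · rintro rfl
      exact ⟨fun b => ⟨1, rfl, rfl⟩, fun _ _ => rfl, fun _ _ => rfl⟩
  rw [this]
  refine ⟨Set.finite_singleton q, 0, ∅, fun σ => ?_, by simp⟩
  rw [prodB_empty, pow_zero, one_smul, show (1 : SymAlg n) = perm 1 from rfl, coeff_perm, typeCount]
  by_cases hσ : 1 = σ
  · subst hσ
    rw [if_pos rfl, show {x ∈ ({q} : Set _) | x 0 = q 0 ∘ (1 : Equiv.Perm (Fin n))} = {q} from ?_]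
    · simp
    · ext x
      simp only [Set.mem_ofPred_eq, Set.mem_singleton_iff, and_iff_left_iff_imp]
      rintro rfl
      rfl
  · rw [if_neg hσ, show {x ∈ ({q} : Set _) | x 0 = q 0 ∘ σ} = ∅ from ?_]
    · simp
    · ext x
      simp only [Set.mem_ofPred_eq, Set.mem_singleton_iff, Set.mem_empty_iff_false, iff_false, not_and]
      rintro rfl h
      apply hσ
      ext i
      have := hq.start_injective (congrFun h i)
      rw [← this]; rfl

/-- The bound on the heights of the splits recorded in `I` is carried along so that `isSplit_lt` can
exclude `j - 1` from `I` here. The exponent grows exactly when `j` is already in `I`. -/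
theorem Noncrossing.isBForm_step (hq : Noncrossing q) {b : ℕ} (j : Fin (n - 1))
    (h : IsBForm q b (partialCovers q b (j + 1))) : IsBForm q b (partialCovers q b (j + 2)) := by
  by_cases hs : IsSplit q b j
  · obtain ⟨hf, e, I, hc, hI⟩ := h
    refine ⟨(hf.union (hf.image (swapBelow b j))).subset fun x hx => ?_,
      e + if j ∈ I then 1 else 0, insert j I, fun σ => ?_, fun i hi => ?_⟩
    · rcases (hq.mem_partialCovers_of_isSplit hs x).1 hx with hx | hx
      · exact Or.inl hx
      · exact Or.inr ⟨_, hx, swapBelow_swapBelow _ _ _⟩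
    · have hne : ∀ i ∈ I, (i : ℕ) + 1 ≠ j := fun i hi hij => by
        obtain ⟨c, hcb, hsc⟩ := hI i hi
        have := hq.isSplit_lt hij hsc hs
        omega
      rw [hq.typeCount_of_isSplit hs hf, Nat.cast_add, hc, hc, ← coeff_one_add_mul, mul_smul_comm,
        one_add_perm_mul_prodB I hne, smul_smul, pow_add]
      split_ifs <;> simp
    · rcases Finset.mem_insert.1 hi with rfl | hi
      · exact ⟨b, le_rfl, hs⟩
      · exact hI i hi
  · rwa [hq.partialCovers_of_not_isSplit hs]

theorem Noncrossing.isBForm_level (hq : Noncrossing q) {b : ℕ}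
    (h : IsBForm q b (partialCovers q b 0)) : ∀ j, j ≤ n → IsBForm q b (partialCovers q b j)
  | 0, _ => h
  | 1, _ => by rwa [partialCovers_one]
  | j + 2, hj => hq.isBForm_step ⟨j, by omega⟩ (hq.isBForm_level h (j + 1) (by omega))

theorem Noncrossing.isBForm (hq : Noncrossing q) : ∀ b, IsBForm q b (partialCovers q b 0)
  | 0 => hq.isBForm_zero
  | b + 1 => by
    rw [partialCovers_succ_zero]
    obtain ⟨hf, e, I, hc, hI⟩ := hq.isBForm_level (hq.isBForm b) n le_rfl
    refine ⟨hf, e, I, hc, fun i hi => ?_⟩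
    obtain ⟨c, hcb, hs⟩ := hI i hi
    exact ⟨c, hcb.trans (Nat.le_succ b), hs⟩

end

/-! ### The path family generating function of a subnetwork -/

/-- The decreasing rearrangement of a tuple. -/
def sortDesc {n : ℕ} (f : Fin n → ℤ) : Fin n → ℤ := f ∘ Tuple.sort (OrderDual.toDual ∘ f)

theorem sortDesc_antitone {n : ℕ} (f : Fin n → ℤ) : Antitone (sortDesc f) :=
  fun _ _ h => Tuple.monotone_sort (OrderDual.toDual ∘ f) h

theorem sortDesc_eq {n : ℕ} {f : Fin n → ℤ} {ρ : Equiv.Perm (Fin n)} (h : Antitone (f ∘ ρ)) :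
    sortDesc f = f ∘ ρ :=
  Tuple.unique_antitone (sortDesc_antitone f) h

/-- Sorting the pairs `(u, v)` lexicographically sorts both coordinates: if `u i > u j`, then `v i ≥
u i - 1 ≥ u j ≥ v j`. Sorting each height separately therefore preserves the edges. -/
theorem exists_sortDesc {n : ℕ} {u v : Fin n → ℤ} (h : ∀ i, u i = v i ∨ u i = v i + 1) :
    ∃ ρ : Equiv.Perm (Fin n), sortDesc u = u ∘ ρ ∧ sortDesc v = v ∘ ρ := by
  let f : Fin n → ℤᵒᵈ ×ₗ ℤᵒᵈ := fun i => toLex (OrderDual.toDual (u i), OrderDual.toDual (v i))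
  have hf := Tuple.monotone_sort f
  have key : ∀ i j, i ≤ j → u (Tuple.sort f j) < u (Tuple.sort f i) ∨
      (u (Tuple.sort f i) = u (Tuple.sort f j) ∧ v (Tuple.sort f j) ≤ v (Tuple.sort f i)) := by
    intro i j hij
    exact (Prod.Lex.le_iff ..).1 (hf hij)
  refine ⟨Tuple.sort f, sortDesc_eq fun i j hij => ?_, sortDesc_eq fun i j hij => ?_⟩
  · have := key i j hij
    simp only [Function.comp_apply]
    omega
  · have := key i j hij
    have h1 := h (Tuple.sort f i)
    have h2 := h (Tuple.sort f j)
    simp only [Function.comp_apply]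
    omega

theorem Rearranges.trans {n : ℕ} {x y z : ℕ → Fin n → ℤ} (h : Rearranges x y)
    (h' : Rearranges y z) : Rearranges x z := fun b => by
  obtain ⟨ρ, h1, h2⟩ := h b
  obtain ⟨ρ', h3, h4⟩ := h' b
  exact ⟨ρ' * ρ, by rw [h1, h3]; rfl, by rw [h2, h4]; rfl⟩

theorem Rearranges.symm {n : ℕ} {x y : ℕ → Fin n → ℤ} (h : Rearranges x y) :
    Rearranges y x := fun b => by
  obtain ⟨ρ, h1, h2⟩ := h b
  refine ⟨ρ⁻¹, ?_, ?_⟩ <;> funext i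
  · simp [h1]
  · simp [h2]

namespace PathFamily
variable {n : ℕ} {lam mu : YoungDiagram}

/-- The abscissa of the `i`-th path at height `b`. -/
def coord (p : PathFamily n lam mu) (b : ℕ) (i : Fin n) : ℤ := (p.path i).x b

theorem coord_step (p : PathFamily n lam mu) (b : ℕ) (i : Fin n) :
    p.coord (b + 1) i = p.coord b i ∨ p.coord (b + 1) i = p.coord b i + 1 :=
  (p.path i).step b

theorem coord_zero (p : PathFamily n lam mu) (i : Fin n) :
    p.coord 0 i = abscissa n mu (p.type i) := (p.path i).finish

theorem ext_coord {p p' : PathFamily n lam mu} (ht : p.type = p'.type)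
    (hc : p.coord = p'.coord) : p = p' := by
  obtain ⟨σ, p⟩ := p
  obtain ⟨τ, p'⟩ := p'
  obtain rfl : σ = τ := ht
  have : p = p' := by
    funext i
    have hx : (p i).x = (p' i).x := by
      funext b
      exact congrFun (congrFun hc b) i
    cases hpi : p i
    cases hqi : p' i
    simp only [hpi, hqi] at hx
    subst hx
    rfl
  rw [this]

/-- Edge multiplicities are the fibre sizes of the map sending a path to its pair of positions at
heights `b + 1` and `b`. Bijections between corresponding fibres glue to a permutation. -/
theorem edges_eq_iff (p p' : PathFamily n lam mu) :
    p.edges = p'.edges ↔ Rearranges p.coord p'.coord := by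
  constructor
  · intro h b
    have key : ∀ c : ℤ × ℤ, Nonempty ({i // (p.coord (b + 1) i, p.coord b i) = c} ≃
        {i // (p'.coord (b + 1) i, p'.coord b i) = c}) := by
      rintro ⟨a, a'⟩
      by_cases h1 : a' = a
      · have := congrFun h (.south a b)
        refine Finite.card_eq.1 ?_
        simpa [edges, LatticePath.Uses, Prod.ext_iff, h1, coord] using this
      · by_cases h2 : a' = a - 1
        · have := congrFun h (.southwest a b)
          refine Finite.card_eq.1 ?_
          simpa [edges, LatticePath.Uses, Prod.ext_iff, h2, coord] using this
        · have : ∀ p : PathFamily n lam mu,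
              IsEmpty {i // (p.coord (b + 1) i, p.coord b i) = (a, a')} := fun p => by
            refine ⟨fun ⟨i, hi⟩ => ?_⟩
            have := p.coord_step b i
            simp only [Prod.mk.injEq] at hi
            omega
          have h3 := this p
          have h4 := this p'
          exact ⟨Equiv.equivOfIsEmpty _ _⟩
    let e := fun c => (key c).some
    have he := Equiv.ofFiberEquiv_map e
    exact ⟨Equiv.ofFiberEquiv e, funext fun i => (congrArg Prod.fst (he i)).symm,
      funext fun i => (congrArg Prod.snd (he i)).symm⟩
  · intro h
    funext e
    cases e with
    | south a b =>
      obtain ⟨ρ, h1, h2⟩ := h b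
      refine Nat.card_congr (ρ.subtypeEquiv fun i => ?_)
      have h1 := congrFun h1 i
      have h2 := congrFun h2 i
      simp only [coord, Function.comp_apply] at h1 h2
      simp only [LatticePath.Uses, h1, h2]
    | southwest a b =>
      obtain ⟨ρ, h1, h2⟩ := h b
      refine Nat.card_congr (ρ.subtypeEquiv fun i => ?_)
      have h1 := congrFun h1 i
      have h2 := congrFun h2 i
      simp only [coord, Function.comp_apply] at h1 h2
      simp only [LatticePath.Uses, h1, h2]

/-- The noncrossing family with the same edges as `p`. -/
def uncrossed (p : PathFamily n lam mu) (b : ℕ) : Fin n → ℤ := sortDesc (p.coord b)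

theorem rearranges_uncrossed (p : PathFamily n lam mu) : Rearranges p.uncrossed p.coord :=
  fun b => exists_sortDesc (p.coord_step b)

end PathFamily

theorem abscissa_strictAnti (n : ℕ) (lam : YoungDiagram) : StrictAnti (abscissa n lam) := by
  intro i j h
  have := lam.rowLen_anti i j (le_of_lt h)
  have : (i : ℕ) < j := h
  simp only [abscissa]
  omega

/-- Were `λ_{i+2} ≥ μ_i + 2`, the rows `i, i + 1, i + 2` and the columns `μ_i, μ_i + 1`, numbered
from 0, would form a forbidden block. The shift of the abscissas by the row index makes the
inequality strict. -/
theorem Avoids32.abscissa_lt {lam mu : YoungDiagram} (h : Avoids32 lam mu) {n : ℕ} {i j : Fin n}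
    (hij : (i : ℕ) + 2 ≤ j) : abscissa n lam j < abscissa n mu i := by
  have key : lam.rowLen (i + 2) ≤ mu.rowLen i + 1 := by
    by_contra hn
    refine h ⟨i, mu.rowLen i, fun a b ha hb => ?_⟩
    rw [YoungDiagram.mem_iff_lt_rowLen, YoungDiagram.mem_iff_lt_rowLen]
    have h1 := lam.rowLen_anti (i + a) (i + 2) (by omega)
    have h2 := mu.rowLen_anti i (i + a) (by omega)
    omega
  have := lam.rowLen_anti (i + 2) j hij
  simp only [abscissa]
  omega

theorem PathFamily.uncrossed_zero {n : ℕ} {lam mu : YoungDiagram} (p : PathFamily n lam mu) :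
    p.uncrossed 0 = abscissa n mu := by
  have h : p.coord 0 ∘ (p.type⁻¹ : Equiv.Perm (Fin n)) = abscissa n mu := by
    funext i
    simp [p.coord_zero]
  rw [PathFamily.uncrossed, sortDesc_eq (ρ := p.type⁻¹) (by
    rw [h]; exact (abscissa_strictAnti n mu).antitone), h]

theorem PathFamily.uncrossed_of_coord {n : ℕ} {lam mu : YoungDiagram} {p : PathFamily n lam mu}
    {b : ℕ} (h : p.coord b = abscissa n lam) : p.uncrossed b = abscissa n lam := by
  rw [PathFamily.uncrossed, sortDesc_eq (ρ := 1) (by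
    rw [h]; exact (abscissa_strictAnti n lam).antitone), h]
  rfl

theorem Rearranges.step {n : ℕ} {x q : ℕ → Fin n → ℤ} (h : Rearranges x q)
    (hq : ∀ b i, q (b + 1) i = q b i ∨ q (b + 1) i = q b i + 1) (b : ℕ) (i : Fin n) :
    x (b + 1) i = x b i ∨ x (b + 1) i = x b i + 1 := by
  obtain ⟨ρ, h1, h2⟩ := h b
  rw [h1, h2]
  exact hq b (ρ i)

theorem monotone_of_step {f : ℕ → ℤ} (h : ∀ b, f (b + 1) = f b ∨ f (b + 1) = f b + 1) :
    Monotone f :=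
  monotone_nat_of_le_succ fun b => by rcases h b with h | h <;> omega

namespace Subnetwork
variable {n : ℕ} {lam mu : YoungDiagram}

/-- All families covering `H` are at their starting abscissas from a common height `N` on. Recording
positions thus identifies those of type `σ` with the type-`σ` elements of `partialCovers
p₀.uncrossed N 0`. -/
theorem exists_beta_eq (hav : Avoids32 lam mu) (H : Subnetwork n lam mu) :
    ∃ (e : ℕ) (I : Finset (Fin (n - 1))), H.beta = ((2 : ℂ) ^ e) • prodB I := by
  obtain ⟨N, -, hN⟩ := H.exists_bound
  obtain ⟨p₀, hp₀⟩ := H.2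
  have hstep := p₀.rearranges_uncrossed.step p₀.coord_step
  have hfin : ∀ b, N ≤ b → p₀.uncrossed b = abscissa n lam := fun b hb =>
    PathFamily.uncrossed_of_coord (funext fun i => hN p₀ hp₀ i b hb)
  have hle : ∀ b i, p₀.uncrossed b i ≤ abscissa n lam i := fun b i => by
    rw [← hfin _ (le_max_right b N)]
    exact monotone_of_step (f := fun b => p₀.uncrossed b i) (fun b => hstep b i) (le_max_left b N)
  have hge : ∀ b i, abscissa n mu i ≤ p₀.uncrossed b i := fun b i => by
    rw [← p₀.uncrossed_zero]
    exact monotone_of_step (f := fun b => p₀.uncrossed b i) (fun b => hstep b i) (Nat.zero_le b)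
  have hq : Noncrossing p₀.uncrossed :=
    { step := hstep
      anti := fun b => sortDesc_antitone _
      gap := fun b c i j hij => (hle b j).trans_lt ((hav.abscissa_lt hij).trans_le (hge c i))
      start_injective := by rw [p₀.uncrossed_zero]; exact (abscissa_strictAnti n mu).injective }
  obtain ⟨-, e, I, hc, -⟩ := hq.isBForm N
  refine ⟨e, I, symAlg_ext fun σ => ?_⟩
  rw [← hc σ, beta, coeff_sum_perm, typeCount, ← Nat.card_coe_set_eq, Nat.cast_inj]
  have hmem : ∀ p : PathFamily n lam mu, H.CoveredBy p ↔ p.coord ∈ partialCovers p₀.uncrossed N 0 :=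
    fun p => by
      rw [CoveredBy, ← hp₀, PathFamily.edges_eq_iff]
      constructor
      · intro h
        have hcov : H.CoveredBy p := by rw [CoveredBy, ← hp₀, PathFamily.edges_eq_iff]; exact h
        refine ⟨h.trans p₀.rearranges_uncrossed.symm, fun c hc => ?_, fun i _ => ?_⟩
        · rw [hfin c hc.le]; exact funext fun i => hN p hcov i c hc.le
        · rw [hfin N le_rfl]; exact hN p hcov i N le_rfl
      · exact fun h => h.1.trans p₀.rearranges_uncrossed
  refine Nat.card_eq_of_bijective (fun p => (⟨p.1.coord, (hmem p.1).1 p.2.1, ?_⟩ :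
    ({x ∈ partialCovers p₀.uncrossed N 0 | x 0 = p₀.uncrossed 0 ∘ σ} : Set _))) ⟨?_, ?_⟩
  · rw [p₀.uncrossed_zero]
    exact funext fun i => by rw [p.1.coord_zero, p.2.2]; rfl
  · intro p p' h
    exact Subtype.ext (PathFamily.ext_coord (p.2.2.trans p'.2.2.symm) (congrArg Subtype.val h))
  · rintro ⟨x, hx, hx0⟩
    rw [p₀.uncrossed_zero] at hx0
    let p : PathFamily n lam mu :=
      { type := σ
        path := fun i =>
          { x := fun b => x b i
            finish := congrFun hx0 i
            step := fun b => hx.1.step hstep b i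
            start := ⟨N + 1, fun b hb => by rw [hx.2.1 b (by omega), hfin b (by omega)]⟩ } }
    exact ⟨⟨p, (hmem p).2 hx, rfl⟩, rfl⟩

end Subnetwork

/-! ### Coefficients of products of power series in several sequences of variables -/

theorem curry_embDomain_sectR {k : ℕ} (r : Fin k) (d : ℕ →₀ ℕ) (r' : Fin k) (b : ℕ) :
    Finsupp.embDomain (Function.Embedding.sectR r ℕ) d (r', b) = if r = r' then d b else 0 := by
  split_ifs with h
  · subst h
    exact Finsupp.embDomain_apply_self _ _ b
  · apply Finsupp.embDomain_of_notMem_range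
    rintro ⟨c, hc⟩
    exact h (congrArg Prod.fst hc)

theorem coeff_inVars {k : ℕ} (r : Fin k) (G : MvPowerSeries ℕ ℂ) (d : ℕ →₀ ℕ) :
    MvPowerSeries.coeff (Finsupp.embDomain (Function.Embedding.sectR r ℕ) d) (inVars r G) =
      MvPowerSeries.coeff d G :=
  MvPowerSeries.coeff_embDomain_rename _ _ _

theorem coeff_inVars_eq_zero {k : ℕ} (r : Fin k) (G : MvPowerSeries ℕ ℂ) (l : Fin k × ℕ →₀ ℕ)
    (h : l ≠ Finsupp.embDomain (Function.Embedding.sectR r ℕ) (l.curry r)) :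
    MvPowerSeries.coeff l (inVars r G) = 0 := by
  apply MvPowerSeries.coeff_rename_eq_zero
  rintro ⟨d, rfl⟩
  apply h
  rw [← Finsupp.embDomain_eq_mapDomain]
  congr 1
  ext b
  rw [Finsupp.curry_apply, curry_embDomain_sectR, if_pos rfl]

/-- A monomial splits uniquely into its parts in the separate sequences of variables, so a single
term of the antidiagonal sum survives. -/
theorem coeff_prod_inVars {k : ℕ} (G : Fin k → MvPowerSeries ℕ ℂ) (m : Fin k × ℕ →₀ ℕ) :
    MvPowerSeries.coeff m (∏ r, inVars r (G r)) =
      ∏ r, MvPowerSeries.coeff (m.curry r) (G r) := by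
  classical
  rw [MvPowerSeries.coeff_prod, Finset.sum_eq_single (Finsupp.equivFunOnFinite.symm fun r =>
    Finsupp.embDomain (Function.Embedding.sectR r ℕ) (m.curry r))]
  · exact Finset.prod_congr rfl fun r _ => coeff_inVars r _ _
  · intro l hl hne
    by_contra h0
    apply hne
    have hl' := fun r => not_imp_comm.1 (coeff_inVars_eq_zero r (G r) (l r))
      (fun h => h0 (Finset.prod_eq_zero (Finset.mem_univ r) h))
    have hsum := (Finset.mem_finsuppAntidiag.1 hl).1
    ext r x
    rw [Finsupp.equivFunOnFinite_symm_apply_apply, hl' r]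
    congr 2
    ext b
    rw [← hsum, Finsupp.curry_apply, Finsupp.curry_apply, Finsupp.finsetSum_apply,
      Finset.sum_eq_single r]
    · intro r' _ hr
      rw [hl' r', curry_embDomain_sectR, if_neg hr]
    · simp
  · intro h
    refine absurd (Finset.mem_finsuppAntidiag.2 ⟨?_, Finset.subset_univ _⟩) h
    ext ⟨r, b⟩
    rw [Finsupp.finsetSum_apply, Finset.sum_eq_single r]
    · rw [Finsupp.equivFunOnFinite_symm_apply_apply, curry_embDomain_sectR, if_pos rfl,
        Finsupp.curry_apply]
    · intro r' _ hr
      rw [Finsupp.equivFunOnFinite_symm_apply_apply, curry_embDomain_sectR, if_neg hr]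
    · simp

/-! ### Lattice paths and elementary symmetric functions -/

namespace LatticePath
variable {A B : ℤ}

theorem ext_x {p p' : LatticePath A B} (h : p.x = p'.x) : p = p' := by
  cases p; cases p'; cases h; rfl

/-- The exponent of the weight of a path: `1` at the heights of the southwest steps. -/
noncomputable def exponent (p : LatticePath A B) : ℕ →₀ ℕ :=
  Finsupp.onFinset (Finset.range p.start.choose) (fun b => (p.x (b + 1) - p.x b).toNat) fun b hb => by
    rw [Finset.mem_range]
    by_contra hn
    have h := p.start.choose_spec
    rw [h b (by omega), h (b + 1) (by omega)] at hb
    simp at hb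

theorem exponent_apply (p : LatticePath A B) (b : ℕ) :
    p.exponent b = (p.x (b + 1) - p.x b).toNat := rfl

theorem exponent_eq (p : LatticePath A B) (b : ℕ) : (p.exponent b : ℤ) = p.x (b + 1) - p.x b := by
  rw [exponent_apply]
  rcases p.step b with h | h <;> omega

theorem exponent_le_one (p : LatticePath A B) (b : ℕ) : p.exponent b ≤ 1 := by
  rw [exponent_apply]
  rcases p.step b with h | h <;> omega

theorem x_eq_sum (p : LatticePath A B) (b : ℕ) :
    p.x b = B + ∑ c ∈ Finset.range b, (p.exponent c : ℤ) := by
  induction b with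
  | zero => simp [p.finish]
  | succ b ih => rw [Finset.sum_range_succ, p.exponent_eq]; omega

theorem exponent_injective : Function.Injective (exponent (A := A) (B := B)) := by
  intro p p' h
  apply ext_x
  funext b
  rw [x_eq_sum, x_eq_sum, h]

theorem _root_.TLImm.exists_sum_range_eq_degree (d : ℕ →₀ ℕ) :
    ∃ N, ∀ b, N ≤ b → ∑ c ∈ Finset.range b, (d c : ℤ) = d.degree := by
  obtain ⟨N, hN⟩ := d.support.exists_nat_subset_range
  refine ⟨N, fun b hb => ?_⟩
  rw [Finsupp.degree_apply, Nat.cast_sum]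
  symm
  exact Finset.sum_subset (hN.trans (Finset.range_mono hb)) fun c _ hc => by
    simpa using hc

theorem degree_exponent (p : LatticePath A B) : (p.exponent.degree : ℤ) = A - B := by
  obtain ⟨N, hN⟩ := exists_sum_range_eq_degree p.exponent
  obtain ⟨M, hM⟩ := p.start
  rw [← hN (max N M) (le_max_left _ _)]
  have := p.x_eq_sum (max N M)
  rw [hM _ (le_max_right _ _)] at this
  omega

theorem exists_exponent_eq {d : ℕ →₀ ℕ} (h1 : ∀ b, d b ≤ 1) (h2 : (d.degree : ℤ) = A - B) :
    ∃ p : LatticePath A B, p.exponent = d := by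
  refine ⟨{ x := fun b => B + ∑ c ∈ Finset.range b, (d c : ℤ)
            finish := by simp
            step := fun b => ?_
            start := ?_ }, ?_⟩
  · have := h1 b
    rw [Finset.sum_range_succ]
    omega
  · obtain ⟨N, hN⟩ := exists_sum_range_eq_degree d
    exact ⟨N, fun b hb => by rw [hN b hb]; omega⟩
  · ext b
    simp [exponent_apply, Finset.sum_range_succ]

end LatticePath

/-- A path is determined by the heights of its southwest steps, which may form any set of `A - B`
heights. -/
theorem coeff_elemSym {A B : ℤ} (d : ℕ →₀ ℕ) :
    MvPowerSeries.coeff d (elemSym (A - B)) =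
      (Nat.card {p : LatticePath A B // p.exponent = d} : ℂ) := by
  classical
  change (if (∀ b, d b ≤ 1) ∧ (d.degree : ℤ) = A - B then (1 : ℂ) else 0) = _
  split_ifs with h
  · obtain ⟨p, hp⟩ := LatticePath.exists_exponent_eq h.1 h.2
    have : Unique {p : LatticePath A B // p.exponent = d} :=
      { default := ⟨p, hp⟩
        uniq := fun p' => Subtype.ext (LatticePath.exponent_injective (p'.2.trans hp.symm)) }
    rw [Nat.card_unique, Nat.cast_one]
  · have : IsEmpty {p : LatticePath A B // p.exponent = d} := ⟨fun ⟨p, hp⟩ => h (by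
      subst hp
      exact ⟨p.exponent_le_one, p.degree_exponent⟩)⟩
    rw [Nat.card_of_isEmpty, Nat.cast_zero]

theorem finite_paths_le {n : ℕ} (A B : Fin n → ℤ) (m : ℕ →₀ ℕ) :
    {p : ∀ i, LatticePath (A i) (B i) | ∑ i, (p i).exponent = m}.Finite := by
  refine Set.Finite.of_finite_image (f := fun p i => (p i).exponent)
    ((Set.Finite.pi' (t := fun _ : Fin n => Set.Iic m) fun _ => Set.finite_Iic m).subset ?_)
    fun p _ p' _ h => funext fun i => LatticePath.exponent_injective (congrFun h i)
  rintro _ ⟨p, hp, rfl⟩ i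
  rw [Set.mem_Iic, ← (show _ = m from hp)]
  exact Finset.single_le_sum (f := fun i => (p i).exponent) (fun _ _ => zero_le)
    (Finset.mem_univ i)

theorem coeff_prod_elemSym {n : ℕ} (A B : Fin n → ℤ) (m : ℕ →₀ ℕ) :
    MvPowerSeries.coeff m (∏ i, elemSym (A i - B i)) =
      (Nat.card {p : ∀ i, LatticePath (A i) (B i) // ∑ i, (p i).exponent = m} : ℂ) := by
  classical
  simp only [MvPowerSeries.coeff_prod, coeff_elemSym, ← Nat.cast_prod, ← Nat.card_pi]
  rw [← Nat.cast_sum, Nat.cast_inj]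
  have hfin : ∀ i (d : ℕ →₀ ℕ), Finite {p : LatticePath (A i) (B i) // p.exponent = d} :=
    fun i d => Finite.of_injective (fun _ => ()) fun p p' _ =>
      Subtype.ext (LatticePath.exponent_injective (p.2.trans p'.2.symm))
  rw [← Finset.sum_coe_sort, ← Nat.card_sigma]
  refine Nat.card_eq_of_bijective (fun x => ⟨fun i => (x.2 i).1, ?_⟩) ⟨?_, fun p => ?_⟩
  · simp only [(x.2 _).2]
    exact (Finset.mem_finsuppAntidiag.1 x.1.2).1
  · rintro ⟨⟨l, hl⟩, p⟩ ⟨⟨l', hl'⟩, p'⟩ h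
    have h : ∀ i, (p i).1 = (p' i).1 := congrFun (congrArg Subtype.val h)
    obtain rfl : l = l' := by
      ext1 i
      exact (p i).2.symm.trans ((congrArg _ (h i)).trans (p' i).2)
    congr 1
    exact funext fun i => Subtype.ext (h i)
  · exact ⟨⟨⟨Finsupp.equivFunOnFinite.symm fun i => (p.1 i).exponent,
      Finset.mem_finsuppAntidiag.2 ⟨p.2, Finset.subset_univ _⟩⟩, fun i => ⟨p.1 i, rfl⟩⟩, rfl⟩

/-! ### Weights of subnetworks -/

namespace PathFamily
variable {n : ℕ} {lam mu : YoungDiagram}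

/-- The exponent of the weight of a path family. -/
noncomputable def exponent (p : PathFamily n lam mu) : ℕ →₀ ℕ := ∑ i, (p.path i).exponent

/-- The edge used by the `i`-th path between the heights `b + 1` and `b`. -/
def edgeAt (p : PathFamily n lam mu) (x : Fin n × ℕ) : Edge :=
  if p.coord (x.2 + 1) x.1 = p.coord x.2 x.1 then .south (p.coord (x.2 + 1) x.1) x.2
  else .southwest (p.coord (x.2 + 1) x.1) x.2

/-- The height of the lower end of an edge. -/
def _root_.TLImm.Edge.height : Edge → ℕ
  | .south _ b => b
  | .southwest _ b => b

theorem uses_iff (p : PathFamily n lam mu) (i : Fin n) (e : Edge) :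
    (p.path i).Uses e ↔ p.edgeAt (i, e.height) = e := by
  have hs := p.coord_step e.height i
  by_cases h : p.coord (e.height + 1) i = p.coord e.height i
  · rw [edgeAt, if_pos h]
    cases e with
    | south a b =>
      rw [Edge.south.injEq]
      exact ⟨fun hu => ⟨hu.1, rfl⟩, fun hu => ⟨hu.1, h.symm.trans hu.1⟩⟩
    | southwest a b =>
      refine ⟨fun hu => ?_, fun hu => by cases hu⟩
      have h1 : p.coord (b + 1) i = a := hu.1
      have h2 : p.coord b i = a - 1 := hu.2
      simp only [Edge.height] at h
      omega
  · rw [edgeAt, if_neg h]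
    cases e with
    | south a b =>
      refine ⟨fun hu => absurd (hu.1.trans hu.2.symm) h, fun hu => by cases hu⟩
    | southwest a b =>
      rw [Edge.southwest.injEq]
      refine ⟨fun hu => ⟨hu.1, rfl⟩, fun hu => ⟨hu.1, ?_⟩⟩
      have h1 : p.coord (b + 1) i = a := hu.1
      change p.coord b i = a - 1
      simp only [Edge.height] at h hs
      omega

theorem height_edgeAt (p : PathFamily n lam mu) (x : Fin n × ℕ) : (p.edgeAt x).height = x.2 := by
  rw [edgeAt]; split_ifs <;> rfl

theorem weight_edgeAt (p : PathFamily n lam mu) (x : Fin n × ℕ) :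
    (p.edgeAt x).weight = MvPowerSeries.X x.2 ^ (p.path x.1).exponent x.2 := by
  have hs := p.coord_step x.2 x.1
  rw [LatticePath.exponent_apply]
  change _ = MvPowerSeries.X x.2 ^ (p.coord (x.2 + 1) x.1 - p.coord x.2 x.1).toNat
  by_cases h : p.coord (x.2 + 1) x.1 = p.coord x.2 x.1
  · rw [edgeAt, if_pos h, h, sub_self, Int.toNat_zero, pow_zero]
    rfl
  · rw [edgeAt, if_neg h, hs.resolve_left h, add_sub_cancel_left, Int.toNat_one, pow_one]
    rfl

/-- The multiplicity of an edge is a fibre size of `edgeAt`, so the product over edges regroups into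
one over paths and heights. Heights from `N` on contribute only factors 1. -/
theorem finprod_weight (p : PathFamily n lam mu) :
    ∏ᶠ e : Edge, e.weight ^ p.edges e = MvPowerSeries.monomial p.exponent 1 := by
  classical
  obtain ⟨N, hN⟩ : ∃ N, ∀ i : Fin n, (p.path i).exponent.support ⊆ Finset.range N := by
    obtain ⟨N, hN⟩ := (Finset.univ.biUnion fun i : Fin n =>
      (p.path i).exponent.support).exists_nat_subset_range
    exact ⟨N, fun i => (Finset.subset_biUnion_of_mem
      (fun i : Fin n => (p.path i).exponent.support) (Finset.mem_univ i)).trans hN⟩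
  set S : Finset (Fin n × ℕ) := Finset.univ ×ˢ Finset.range N with hS
  rw [finprod_eq_prod_of_mulSupport_subset (s := S.image p.edgeAt)]
  · have hcard : ∀ e ∈ S.image p.edgeAt, p.edges e = (S.filter fun x => p.edgeAt x = e).card := by
      intro e he
      obtain ⟨⟨j, b⟩, hx, rfl⟩ := Finset.mem_image.1 he
      have hb : b < N := by simpa [hS] using hx
      rw [edges, ← Fintype.card_coe, ← Nat.card_eq_fintype_card]
      refine Nat.card_congr
        { toFun := fun i => ⟨(i.1, b), ?_⟩
          invFun := fun x => ⟨x.1.1, ?_⟩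
          left_inv := fun i => rfl
          right_inv := fun x => ?_ }
      · have := (p.uses_iff _ _).1 i.2
        rw [height_edgeAt] at this
        simpa [hS, hb] using this
      · have h := (Finset.mem_filter.1 x.2).2
        have h' := congrArg Edge.height h
        rw [height_edgeAt, height_edgeAt] at h'
        rw [uses_iff, height_edgeAt]
        exact (congrArg p.edgeAt (show (x.1.1, b) = x.1 from Prod.ext rfl h'.symm)).trans h
      · have h := congrArg Edge.height (Finset.mem_filter.1 x.2).2
        rw [height_edgeAt, height_edgeAt] at h
        exact Subtype.ext (Prod.ext rfl h.symm)
    have hmaps : ∀ x ∈ S, p.edgeAt x ∈ S.image p.edgeAt := fun x hx =>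
      Finset.mem_image_of_mem _ hx
    rw [Finset.prod_congr rfl fun e he => by rw [hcard e he, ← Finset.prod_const],
      Finset.prod_fiberwise_of_maps_to' hmaps Edge.weight,
      hS, Finset.prod_product, exponent, ← Finset.prod_const_one (s := (Finset.univ : Finset (Fin n))),
      ← MvPowerSeries.prod_monomial]
    refine Finset.prod_congr rfl fun i _ => ?_
    rw [MvPowerSeries.monomial_one_eq, Finsupp.prod_of_support_subset _ (hN i) _ (by simp)]
    exact Finset.prod_congr rfl fun b _ => p.weight_edgeAt (i, b)
  · intro e he
    rw [Function.mem_mulSupport] at he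
    have h0 : p.edges e ≠ 0 := fun h => he (by rw [h, pow_zero])
    obtain ⟨⟨i, hi⟩⟩ := (Nat.card_ne_zero.1 h0).1
    rw [p.uses_iff] at hi
    rw [Finset.coe_image]
    refine ⟨(i, e.height), ?_, hi⟩
    simp only [hS, Finset.coe_product, Set.mem_prod, Finset.mem_coe, Finset.mem_univ, true_and]
    apply hN i
    rw [Finsupp.mem_support_iff]
    intro h
    apply he
    rw [← hi, weight_edgeAt, h, pow_zero, one_pow]

theorem finite_exponent (m : ℕ →₀ ℕ) : {p : PathFamily n lam mu | p.exponent = m}.Finite := by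
  have h : ∀ σ : Equiv.Perm (Fin n), (PathFamily.mk (lam := lam) (mu := mu) σ ''
      {p | ∑ i, (p i).exponent = m}).Finite := fun σ =>
    (finite_paths_le (abscissa n lam) (fun i => abscissa n mu (σ i)) m).image _
  refine (Set.finite_iUnion h).subset ?_
  rintro ⟨σ, p⟩ hp
  exact Set.mem_iUnion.2 ⟨σ, Set.mem_image_of_mem _ hp⟩

end PathFamily

namespace Subnetwork
variable {n : ℕ} {lam mu : YoungDiagram}

/-- The exponent of the weight of a subnetwork. -/
noncomputable def exponent (H : Subnetwork n lam mu) : ℕ →₀ ℕ := H.2.choose.exponent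

theorem wt_eq (H : Subnetwork n lam mu) : H.wt = MvPowerSeries.monomial H.exponent 1 := by
  rw [exponent, ← PathFamily.finprod_weight, H.2.choose_spec]
  rfl

/-- The weight depends on the edges alone, so the covering family chosen in `Subnetwork.exponent` is
immaterial. -/
theorem CoveredBy.exponent_eq {H : Subnetwork n lam mu} {p : PathFamily n lam mu}
    (h : H.CoveredBy p) : p.exponent = H.exponent := by
  classical
  have h1 := H.wt_eq
  rw [wt, ← (show p.edges = H.1 from h), p.finprod_weight] at h1
  have h2 := congrArg (MvPowerSeries.coeff p.exponent) h1
  rw [MvPowerSeries.coeff_monomial_same, MvPowerSeries.coeff_monomial] at h2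
  by_contra hne
  rw [if_neg hne] at h2
  exact one_ne_zero h2

theorem finite_exponent (m : ℕ →₀ ℕ) : {H : Subnetwork n lam mu | H.exponent = m}.Finite := by
  refine ((PathFamily.finite_exponent (n := n) (lam := lam) (mu := mu) m).image
    fun p => (⟨p.edges, p, rfl⟩ : Subnetwork n lam mu)).subset ?_
  intro H hH
  obtain ⟨p, hp⟩ := H.2
  refine ⟨p, (CoveredBy.exponent_eq (H := H) hp).trans hH, Subtype.ext hp⟩

/-- Each path family covers exactly one subnetwork, so the covers partition the families. -/
theorem sum_beta_coeff (m : ℕ →₀ ℕ) (w : Equiv.Perm (Fin n)) :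
    ∑ H ∈ (finite_exponent (n := n) (lam := lam) (mu := mu) m).toFinset, H.beta.coeff (.op w) =
      (Nat.card {p : PathFamily n lam mu // p.exponent = m ∧ p.type = w} : ℂ) := by
  simp only [beta, coeff_sum_perm]
  rw [← Nat.cast_sum, Nat.cast_inj]
  have hfin : ∀ H : Subnetwork n lam mu, Finite {p // H.CoveredBy p ∧ p.type = w} := fun H =>
    (H.finite_covers.subset fun p hp => hp.1 :
      {p | H.CoveredBy p ∧ p.type = w}.Finite).to_subtype
  rw [← Finset.sum_coe_sort, ← Nat.card_sigma]
  refine Nat.card_eq_of_bijective (fun x => ⟨x.2.1, ?_, x.2.2.2⟩) ⟨?_, fun p => ?_⟩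
  · rw [x.2.2.1.exponent_eq]
    exact (Set.Finite.mem_toFinset (finite_exponent m)).1 x.1.2
  · rintro ⟨⟨H, hH⟩, p, hp⟩ ⟨⟨H', hH'⟩, p', hp'⟩ h
    obtain rfl : p = p' := congrArg Subtype.val h
    obtain rfl : H = H' := Subtype.ext (hp.1.symm.trans hp'.1)
    rfl
  · have hc : CoveredBy (⟨p.1.edges, p.1, rfl⟩ : Subnetwork n lam mu) p.1 := rfl
    exact ⟨⟨⟨⟨p.1.edges, p.1, rfl⟩, (Set.Finite.mem_toFinset _).2 (hc.exponent_eq.symm.trans p.2.1)⟩,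
      p.1, hc, p.2.2⟩, rfl⟩

end Subnetwork

theorem coeff_prod_jacobiTrudi {n : ℕ} (lam mu : YoungDiagram) (w : Equiv.Perm (Fin n))
    (m : ℕ →₀ ℕ) : MvPowerSeries.coeff m (∏ i, jacobiTrudi n lam mu i (w i)) =
      ∑ H ∈ (Subnetwork.finite_exponent (n := n) (lam := lam) (mu := mu) m).toFinset,
        H.beta.coeff (.op w) := by
  have : ∀ i, jacobiTrudi n lam mu i (w i) =
      elemSym (abscissa n lam i - abscissa n mu (w i)) := fun i => by
    rw [jacobiTrudi, Matrix.of_apply]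
    congr 1
    simp only [abscissa]
    ring
  rw [Subnetwork.sum_beta_coeff]
  simp only [this]
  rw [coeff_prod_elemSym (abscissa n lam) (fun i => abscissa n mu (w i)), Nat.cast_inj]
  refine Nat.card_eq_of_bijective (fun p => ⟨⟨w, p.1⟩, p.2, rfl⟩) ⟨?_, ?_⟩
  · rintro ⟨p, hp⟩ ⟨p', hp'⟩ h
    have h := congrArg Subtype.val h
    simp only [PathFamily.mk.injEq, heq_eq_eq, true_and] at h
    exact Subtype.ext h
  · rintro ⟨⟨σ, p⟩, hp, rfl⟩
    exact ⟨⟨p, hp⟩, rfl⟩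

/-! ### Multinetworks -/

namespace Multinetwork
variable {n k : ℕ} {lam mu : Fin k → YoungDiagram}

/-- The multinetworks whose weight has the given exponent. -/
noncomputable def ofExponent (n : ℕ) {k : ℕ} (lam mu : Fin k → YoungDiagram)
    (m : Fin k × ℕ →₀ ℕ) : Finset (Multinetwork n lam mu) :=
  Fintype.piFinset fun r =>
    (Subnetwork.finite_exponent (n := n) (lam := lam r) (mu := mu r) (m.curry r)).toFinset

theorem mem_ofExponent {m : Fin k × ℕ →₀ ℕ} {H : Multinetwork n lam mu} :
    H ∈ ofExponent n lam mu m ↔ ∀ r, (H r).exponent = m.curry r := by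
  rw [ofExponent]
  exact Fintype.mem_piFinset.trans (forall_congr' fun r => Set.Finite.mem_toFinset _)

open Classical in
theorem coeff_wt (H : Multinetwork n lam mu) (m : Fin k × ℕ →₀ ℕ) :
    MvPowerSeries.coeff m H.wt = if H ∈ ofExponent n lam mu m then 1 else 0 := by
  simp only [wt, coeff_prod_inVars, Subnetwork.wt_eq, MvPowerSeries.coeff_monomial,
    mem_ofExponent, Finset.prod_ite_zero, Finset.prod_const_one, Finset.mem_univ, true_imp_iff,
    eq_comm]

/-- Once the common type is fixed, the families covering the components are chosen independently. -/
theorem beta_coeff (H : Multinetwork n lam mu) (w : Equiv.Perm (Fin n)) :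
    H.beta.coeff (.op w) = ∏ r, (H r).beta.coeff (.op w) := by
  simp only [beta, Subnetwork.beta, coeff_sum_perm]
  rw [← Nat.cast_prod, ← Nat.card_pi, Nat.cast_inj]
  exact Nat.card_congr (Equiv.subtypePiEquivPi (p := fun r (p : PathFamily n (lam r) (mu r)) =>
    (H r).CoveredBy p ∧ p.type = w))

theorem coeff_imm (f : Equiv.Perm (Fin n) → ℂ) (m : Fin k × ℕ →₀ ℕ) :
    MvPowerSeries.coeff m (imm f (hadamardJT n lam mu)) =
      ∑ H ∈ ofExponent n lam mu m, ∑ w, f w * H.beta.coeff (.op w) := by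
  rw [Finset.sum_comm, imm, map_sum]
  refine Finset.sum_congr rfl fun w _ => ?_
  simp only [MvPowerSeries.coeff_smul, hadamardJT, Matrix.of_apply]
  rw [Finset.prod_comm]
  simp only [← map_prod]
  rw [coeff_prod_inVars, ← Finset.mul_sum]
  simp only [coeff_prod_jacobiTrudi, beta_coeff]
  rw [Finset.prod_univ_sum]
  rfl

end Multinetwork

/-! ### Monomial positivity -/

/-- The multiset of nonzero exponents. -/
def expShape (d : ℕ →₀ ℕ) : Multiset ℕ := d.support.val.map d

/-- The Young diagram whose row lengths are the nonzero exponents. -/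
noncomputable def expDiagram (d : ℕ →₀ ℕ) : YoungDiagram :=
  YoungDiagram.ofRowLens ((expShape d).sort (· ≥ ·)) (Multiset.pairwise_sort _ _).sortedGE

theorem rowLens_expDiagram (d : ℕ →₀ ℕ) : ((expDiagram d).rowLens : Multiset ℕ) = expShape d := by
  rw [expDiagram, YoungDiagram.rowLens_ofRowLens_eq_self, Multiset.sort_eq]
  intro x hx
  rw [Multiset.mem_sort, expShape, Multiset.mem_map] at hx
  obtain ⟨b, hb, rfl⟩ := hx
  exact Nat.pos_of_ne_zero (Finsupp.mem_support_iff.1 hb)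

theorem rowLens_coe_injective {nu nu' : YoungDiagram}
    (h : (nu.rowLens : Multiset ℕ) = nu'.rowLens) : nu = nu' := by
  have h' : nu.rowLens = nu'.rowLens :=
    (Multiset.coe_eq_coe.1 h).eq_of_sortedGE nu.rowLens_sorted nu'.rowLens_sorted
  rw [← YoungDiagram.ofRowLens_to_rowLens_eq_self (μ := nu),
    ← YoungDiagram.ofRowLens_to_rowLens_eq_self (μ := nu')]
  congr 1

open Classical in
theorem coeff_monoSym (nu : YoungDiagram) (d : ℕ →₀ ℕ) :
    MvPowerSeries.coeff d (monoSym nu) = if expDiagram d = nu then 1 else 0 := by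
  change (if expShape d = (nu.rowLens : Multiset ℕ) then (1 : ℂ) else 0) = _
  refine if_congr ?_ rfl rfl
  rw [← rowLens_expDiagram]
  exact ⟨rowLens_coe_injective, fun h => by rw [h]⟩

/-- The exponent with the row lengths of `nu`. -/
noncomputable def rowExponent (nu : YoungDiagram) : ℕ →₀ ℕ :=
  Finsupp.onFinset (Finset.range (nu.colLen 0)) nu.rowLen fun b hb => by
    rw [Finset.mem_range, ← YoungDiagram.mem_iff_lt_colLen, YoungDiagram.mem_iff_lt_rowLen]
    omega

theorem support_rowExponent (nu : YoungDiagram) :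
    (rowExponent nu).support = Finset.range (nu.colLen 0) := by
  ext b
  rw [Finsupp.mem_support_iff, Finset.mem_range, ← YoungDiagram.mem_iff_lt_colLen,
    YoungDiagram.mem_iff_lt_rowLen]
  exact Nat.pos_iff_ne_zero.symm

theorem expShape_rowExponent (nu : YoungDiagram) : expShape (rowExponent nu) = nu.rowLens := by
  rw [expShape, support_rowExponent]
  rfl

/-- The degree bounds both the first row and the number of rows, so the diagram fits into a `D × D`
square. -/
theorem finite_degree_rowExponent_le (D : ℕ) :
    {nu : YoungDiagram | (rowExponent nu).degree ≤ D}.Finite := by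
  refine Set.Finite.of_finite_image (f := YoungDiagram.cells)
    ((Finset.finite_toSet (Finset.range D ×ˢ Finset.range D).powerset).subset ?_)
    fun nu _ nu' _ h => YoungDiagram.ext h
  rintro _ ⟨nu, hnu, rfl⟩
  have hnu : (rowExponent nu).degree ≤ D := hnu
  rw [Finset.mem_coe, Finset.mem_powerset]
  rintro ⟨i, j⟩ hij
  rw [YoungDiagram.mem_cells] at hij
  have hj := nu.up_left_mem (Nat.zero_le i) le_rfl hij
  have hi := nu.up_left_mem le_rfl (Nat.zero_le j) hij
  rw [YoungDiagram.mem_iff_lt_rowLen] at hj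
  rw [YoungDiagram.mem_iff_lt_colLen] at hi
  have h1 : nu.rowLen 0 ≤ (rowExponent nu).degree := Finsupp.le_degree 0 (rowExponent nu)
  have h2 : nu.colLen 0 ≤ (rowExponent nu).degree := by
    rw [Finsupp.degree_apply]
    calc nu.colLen 0 = (rowExponent nu).support.card := by rw [support_rowExponent, Finset.card_range]
      _ ≤ _ := by
        rw [Finset.card_eq_sum_ones]
        exact Finset.sum_le_sum fun b hb => Nat.pos_of_ne_zero (Finsupp.mem_support_iff.1 hb)
  simp only [Finset.mem_product, Finset.mem_range]
  omega

/-- Equal fibre sizes over nonzero values give a bijection of the supports. It extends to all of `ℕ`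
because both complements are countably infinite. -/
theorem exists_perm_of_expShape_eq {d d' : ℕ →₀ ℕ} (h : expShape d = expShape d') :
    ∃ g : Equiv.Perm ℕ, ∀ b, d' (g b) = d b := by
  classical
  have key : ∀ v : ℕ, Nonempty ({b : {b // b ∈ d.support} // d b = v} ≃
      {b : {b // b ∈ d'.support} // d' b = v}) := by
    have hc : ∀ (d : ℕ →₀ ℕ) (v : ℕ), Nat.card {b : {b // b ∈ d.support} // d b = v} =
        (expShape d).count v := by
      intro d v
      rw [expShape, Multiset.count_map, Nat.card_eq_fintype_card, Fintype.card_subtype,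
        Finset.univ_eq_attach]
      rw [← Finset.card_map (Function.Embedding.subtype _)]
      rw [show Multiset.filter (fun a => v = d a) d.support.val =
        (d.support.filter fun a => v = d a).val from rfl, Finset.card_val]
      congr 1
      ext b
      simp only [Finset.mem_map, Finset.mem_filter, Finset.mem_attach, true_and,
        Function.Embedding.subtype_apply, Subtype.exists, exists_and_right, exists_eq_right]
      constructor
      · rintro ⟨hb, rfl⟩; exact ⟨hb, rfl⟩
      · rintro ⟨hb, rfl⟩; exact ⟨hb, rfl⟩
    intro v
    refine Finite.card_eq.1 ?_
    rw [hc, hc, h]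
  let e := Equiv.ofFiberEquiv (f := fun b : {b // b ∈ d.support} => d b)
    (g := fun b : {b // b ∈ d'.support} => d' b) fun v => (key v).some
  have he : ∀ b, d' (e b) = d b := fun b => Equiv.ofFiberEquiv_map
    (g := fun b : {b // b ∈ d'.support} => d' b) (fun v => (key v).some) b
  have hinf : ∀ d : ℕ →₀ ℕ, Infinite {b // ¬ b ∈ d.support} := fun d =>
    (Finset.finite_toSet d.support).infinite_compl.to_subtype
  have := hinf d
  have := hinf d'
  obtain ⟨e'⟩ := nonempty_equiv_of_countable (α := {b // ¬ b ∈ d.support})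
    (β := {b // ¬ b ∈ d'.support})
  refine ⟨Equiv.subtypeCongr e e', fun b => ?_⟩
  by_cases hb : b ∈ d.support
  · have : Equiv.subtypeCongr e e' b = e ⟨b, hb⟩ := by simp [Equiv.subtypeCongr, hb]
    rw [this]
    exact he ⟨b, hb⟩
  · have h1 : Equiv.subtypeCongr e e' b = e' ⟨b, hb⟩ := by simp [Equiv.subtypeCongr, hb]
    have h2 := (e' ⟨b, hb⟩).2
    rw [← h1, Finsupp.notMem_support_iff] at h2
    rw [h2, Finsupp.notMem_support_iff.1 hb]

theorem rename_elemSym (g : Equiv.Perm ℕ) (a : ℤ) :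
    MvPowerSeries.rename g.toEmbedding (elemSym a) = elemSym a := by
  classical
  ext d
  obtain ⟨d, rfl⟩ : ∃ d', d = Finsupp.embDomain g.toEmbedding d' :=
    ⟨Finsupp.embDomain g.symm.toEmbedding d, by
      ext b
      obtain ⟨c, rfl⟩ := g.surjective b
      rw [← Equiv.coe_toEmbedding, Finsupp.embDomain_apply_self]
      have := Finsupp.embDomain_apply_self g.symm.toEmbedding d (g c)
      simpa using this.symm⟩
  rw [MvPowerSeries.coeff_embDomain_rename]
  change (if (∀ b, d b ≤ 1) ∧ (d.degree : ℤ) = a then (1 : ℂ) else 0) =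
    if (∀ b, Finsupp.embDomain g.toEmbedding d b ≤ 1) ∧
      ((Finsupp.embDomain g.toEmbedding d).degree : ℤ) = a then (1 : ℂ) else 0
  refine if_congr (and_congr ?_ ?_) rfl rfl
  · have hemb : ∀ b, Finsupp.embDomain g.toEmbedding d (g b) = d b :=
      Finsupp.embDomain_apply_self g.toEmbedding d
    refine ⟨fun h b => ?_, fun h b => by rw [← hemb]; exact h (g b)⟩
    obtain ⟨c, rfl⟩ := g.surjective b
    rw [hemb]
    exact h c
  · rw [Finsupp.degree_apply, Finsupp.degree_apply, Finsupp.support_embDomain, Finset.sum_map]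
    simp only [Finsupp.embDomain_apply_self]

theorem coeff_prod_jacobiTrudi_congr {n : ℕ} (lam mu : YoungDiagram) (w : Equiv.Perm (Fin n))
    {d d' : ℕ →₀ ℕ} (h : expShape d = expShape d') :
    MvPowerSeries.coeff d (∏ i, jacobiTrudi n lam mu i (w i)) =
      MvPowerSeries.coeff d' (∏ i, jacobiTrudi n lam mu i (w i)) := by
  obtain ⟨g, hg⟩ := exists_perm_of_expShape_eq h
  have hd : d' = Finsupp.embDomain g.toEmbedding d := by
    ext b
    obtain ⟨c, rfl⟩ := g.surjective b
    rw [hg, ← Equiv.coe_toEmbedding, Finsupp.embDomain_apply_self]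
  rw [hd, ← MvPowerSeries.coeff_embDomain_rename g.toEmbedding, map_prod]
  simp only [jacobiTrudi, Matrix.of_apply, rename_elemSym]

theorem coeff_imm_congr {n k : ℕ} {lam mu : Fin k → YoungDiagram} (f : Equiv.Perm (Fin n) → ℂ)
    {m m' : Fin k × ℕ →₀ ℕ} (h : ∀ r, expShape (m.curry r) = expShape (m'.curry r)) :
    MvPowerSeries.coeff m (imm f (hadamardJT n lam mu)) =
      MvPowerSeries.coeff m' (imm f (hadamardJT n lam mu)) := by
  rw [imm, map_sum, map_sum]
  refine Finset.sum_congr rfl fun w _ => ?_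
  simp only [MvPowerSeries.coeff_smul, hadamardJT, Matrix.of_apply]
  rw [Finset.prod_comm]
  simp only [← map_prod]
  rw [coeff_prod_inVars, coeff_prod_inVars,
    Finset.prod_congr rfl fun r _ => coeff_prod_jacobiTrudi_congr (lam r) (mu r) w (h r)]

/-- By symmetry a coefficient depends only on the tuple of shapes, and the degree bound leaves
finitely many of these. The coefficient of a product of monomial functions is read off at the
representative exponent `M nu`. -/
theorem isIntegrallyMonomialPositive_of_coeff {k : ℕ} {F : MvPowerSeries (Fin k × ℕ) ℂ}
    (hnat : ∀ m, ∃ a : ℕ, MvPowerSeries.coeff m F = a)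
    (hsymm : ∀ m m' : Fin k × ℕ →₀ ℕ, (∀ r, expShape (m.curry r) = expShape (m'.curry r)) →
      MvPowerSeries.coeff m F = MvPowerSeries.coeff m' F)
    (D : Fin k → ℕ)
    (hdeg : ∀ m : Fin k × ℕ →₀ ℕ, MvPowerSeries.coeff m F ≠ 0 → ∀ r, (m.curry r).degree ≤ D r) :
    IsIntegrallyMonomialPositive F := by
  classical
  choose a ha using hnat
  let M : (Fin k → YoungDiagram) → Fin k × ℕ →₀ ℕ := fun nu =>
    (Finsupp.equivFunOnFinite.symm fun r => rowExponent (nu r)).uncurry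
  have hM : ∀ nu r, (M nu).curry r = rowExponent (nu r) := fun nu r => by
    simp only [M, Finsupp.curry_uncurry]
    rfl
  have hfin : {nu | a (M nu) ≠ 0}.Finite := by
    refine (Set.Finite.pi' fun r => finite_degree_rowExponent_le (D r)).subset fun nu hnu r => ?_
    have := hdeg (M nu) (by rw [ha]; exact Nat.cast_ne_zero.2 hnu) r
    rwa [hM] at this
  refine ⟨Finsupp.onFinset hfin.toFinset (fun nu => a (M nu))
    fun nu h => hfin.mem_toFinset.2 h, ?_⟩
  ext m
  rw [Finsupp.onFinset_sum _ (by simp), map_sum]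
  have hm : MvPowerSeries.coeff m F = a (M fun r => expDiagram (m.curry r)) := by
    rw [← ha]
    refine hsymm _ _ fun r => ?_
    rw [hM, expShape_rowExponent, rowLens_expDiagram]
  have hterm : ∀ nu, MvPowerSeries.coeff m ((((a (M nu) : ℕ) : ℂ)) • multiMonoSym nu) =
      if nu = fun r => expDiagram (m.curry r) then (a (M nu) : ℂ) else 0 := by
    intro nu
    rw [MvPowerSeries.coeff_smul, multiMonoSym, coeff_prod_inVars]
    simp only [coeff_monoSym, Finset.prod_ite_zero, Finset.prod_const_one, Finset.mem_univ,
      true_imp_iff, mul_ite, mul_one, mul_zero]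
    refine if_congr ?_ rfl rfl
    rw [funext_iff]
    exact forall_congr' fun r => eq_comm
  simp only [hterm]
  rw [Finset.sum_ite_eq', hm]
  split_ifs with h
  · rfl
  · rw [Set.Finite.mem_toFinset, Set.mem_ofPred_eq, not_not] at h
    rw [h, Nat.cast_zero]

theorem IsIntegrallyMonomialPositive.isMonomialPositive {k : ℕ}
    {F : MvPowerSeries (Fin k × ℕ) ℂ} (h : IsIntegrallyMonomialPositive F) :
    IsMonomialPositive F := by
  obtain ⟨c, rfl⟩ := h
  refine ⟨c.mapRange (fun a : ℕ => (a : ℝ)) Nat.cast_zero, fun nu => ?_, ?_⟩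
  · rw [Finsupp.mapRange_apply]
    exact Nat.cast_nonneg _
  · rw [Finsupp.sum_mapRange_index (by simp)]
    simp

/-! ### Exponents of two and immanants of multinetworks -/

theorem Subnetwork.eps_eq {n : ℕ} {lam mu : YoungDiagram} {H : Subnetwork n lam mu} {e : ℕ}
    {I : Finset (Fin (n - 1))} (h : H.beta = ((2 : ℂ) ^ e) • prodB I) : H.eps = e := by
  -- The infimum defining `eps` is over a singleton, since a power of two determines its exponent.
  have : {e' : ℕ | ∃ ψ : KauffmanDiagram n,
      expand (theta n H.beta) = Finsupp.single ψ ((2 : ℂ) ^ e')} = {e} := by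
    ext e'
    rw [h, expand_theta_smul_prodB]
    simp only [Set.mem_ofPred_eq, Set.mem_singleton_iff]
    constructor
    · rintro ⟨ψ, hψ⟩
      rcases Finsupp.single_eq_single_iff _ _ _ _ |>.1 hψ with h1 | h1
      · have h2 : (2 : ℕ) ^ e = 2 ^ e' := by exact_mod_cast h1.2
        exact (Nat.pow_right_injective le_rfl h2).symm
      · exact absurd h1.1 (pow_ne_zero _ two_ne_zero)
    · rintro rfl
      exact ⟨_, rfl⟩
  rw [Subnetwork.eps, this, csInf_singleton]

theorem Subnetwork.exists_beta_eq_eps {n : ℕ} {lam mu : YoungDiagram} (hav : Avoids32 lam mu)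
    (H : Subnetwork n lam mu) :
    ∃ I : Finset (Fin (n - 1)), H.beta = ((2 : ℂ) ^ H.eps) • prodB I := by
  obtain ⟨e, I, h⟩ := H.exists_beta_eq hav
  exact ⟨I, by rw [Subnetwork.eps_eq h, h]⟩

theorem Subnetwork.degree_exponent {n : ℕ} {lam mu : YoungDiagram} (H : Subnetwork n lam mu) :
    (H.exponent.degree : ℤ) = ∑ i, abscissa n lam i - ∑ i, abscissa n mu i := by
  rw [Subnetwork.exponent, PathFamily.exponent, map_sum, Nat.cast_sum]
  simp only [LatticePath.degree_exponent, Finset.sum_sub_distrib]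
  rw [Equiv.sum_comp _ (abscissa n mu)]

namespace Multinetwork
variable {n k : ℕ} {lam mu : Fin k → YoungDiagram}

/-- Coefficients multiply over the components: the powers of two add their exponents, and the
indicators of the supports combine to that of the intersection of the `I r`. -/
theorem exists_beta_eq (hk : 1 ≤ k) (hav : ∀ r, Avoids32 (lam r) (mu r))
    (H : Multinetwork n lam mu) :
    ∃ I : Finset (Fin (n - 1)), H.beta = ((2 : ℂ) ^ H.eps) • prodB I := by
  choose I hI using fun r => (H r).exists_beta_eq_eps (hav r)
  refine ⟨Finset.univ.inf I, symAlg_ext fun σ => ?_⟩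
  classical
  rw [beta_coeff, Finset.prod_congr rfl fun r _ => by rw [hI r]]
  simp only [MonoidAlgebra.coeff_smul, Finsupp.smul_apply, coeff_prodB, splitsOutside_inf hk,
    smul_eq_mul, Finset.prod_mul_distrib, Finset.prod_ite_zero, Finset.prod_const_one,
    Finset.mem_univ, true_imp_iff, eps, Finset.prod_pow_eq_pow_sum]

open Classical in
theorem sum_fTau_mul_beta_coeff {H : Multinetwork n lam mu} {I : Finset (Fin (n - 1))}
    (h : H.beta = ((2 : ℂ) ^ H.eps) • prodB I) (τ : KauffmanDiagram n) :
    ∑ w, fTau τ w * H.beta.coeff (.op w) = if τ = tau I then (2 : ℂ) ^ H.eps else 0 := by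
  rw [sum_fTau, ← symAlg_eq_sum, h, expand_theta_smul_prodB, Finsupp.single_apply]
  simp only [eq_comm]

theorem isIntegrallyMonomialPositive_imm (f : Equiv.Perm (Fin n) → ℂ)
    (h : ∀ H : Multinetwork n lam mu, ∃ a : ℕ, ∑ w, f w * H.beta.coeff (.op w) = a) :
    IsIntegrallyMonomialPositive (imm f (hadamardJT n lam mu)) := by
  choose a ha using h
  refine isIntegrallyMonomialPositive_of_coeff (fun m => ?_) (fun m m' => coeff_imm_congr f)
    -- This is the degree of every multinetwork in the `r`-th sequence, the total displacement of
    -- its paths. A nonzero coefficient provides a multinetwork, so `toNat` truncates nothing there.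
    (fun r => (∑ i, abscissa n (lam r) i - ∑ i, abscissa n (mu r) i).toNat) fun m hm r => ?_
  · exact ⟨∑ H ∈ ofExponent n lam mu m, a H, by rw [coeff_imm, Nat.cast_sum]; simp only [ha]⟩
  · rw [coeff_imm] at hm
    obtain ⟨H, hH, -⟩ := Finset.exists_ne_zero_of_sum_ne_zero hm
    have := (H r).degree_exponent
    rw [mem_ofExponent.1 hH r] at this
    omega

end Multinetwork

/-! ### The determinant and the main theorem -/

theorem det_eq_imm {n : ℕ} {R : Type*} [CommRing R] [Algebra ℂ R] (A : Matrix (Fin n) (Fin n) R) :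
    A.det = imm (fun w => ((Equiv.Perm.sign w : ℤ) : ℂ)) A := by
  rw [← Matrix.det_transpose, Matrix.det_apply', imm]
  refine Finset.sum_congr rfl fun w _ => ?_
  rw [Int.cast_smul_eq_zsmul, zsmul_eq_mul]
  rfl

end TLImm

theorem mainTheorem2 (n k : ℕ) (hk : 1 ≤ k) (lam mu : Fin k → YoungDiagram)
    (hsub : ∀ r, mu r ≤ lam r) (hlen : ∀ r, (lam r).colLen 0 ≤ n)
    (havoid : ∀ r, Avoids32 (lam r) (mu r)) :
    (∀ (H : Multinetwork n lam mu) (r : Fin k), ∃ ψ : KauffmanDiagram n,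
      expand (theta n (H r).beta) = Finsupp.single ψ ((2 : ℂ) ^ (H r).eps)) ∧
    (∀ τ : KauffmanDiagram n,
      (∀ I : Finset (Fin (n - 1)), IsTauOf τ I →
        HasSum
          (fun H : {H : Multinetwork n lam mu // H.beta = ((2 : ℂ) ^ H.eps) • prodB I} =>
            ((2 : ℂ) ^ H.1.eps) • H.1.wt)
          (imm (fTau τ) (hadamardJT n lam mu))) ∧
      ((¬ ∃ I : Finset (Fin (n - 1)), IsTauOf τ I) →
        imm (fTau τ) (hadamardJT n lam mu) = 0) ∧
      IsMonomialPositive (imm (fTau τ) (hadamardJT n lam mu))) ∧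
    IsIntegrallyMonomialPositive (hadamardJT n lam mu).det := by
  classical
  choose J hJ using fun H : Multinetwork n lam mu => H.exists_beta_eq hk havoid
  refine ⟨fun H r => ?_, fun τ => ⟨fun I hI => ?_, fun hτ => ?_, ?_⟩, ?_⟩
  · obtain ⟨I, hI⟩ := (H r).exists_beta_eq_eps (havoid r)
    exact ⟨tau I, by rw [hI, expand_theta_smul_prodB]⟩
  · rw [isTauOf_iff] at hI
    subst hI
    -- As `β(H)` is always `2^ε(H) B(J H)`, the condition indexing the sum just says `J H = I`.
    have hiff : ∀ H : Multinetwork n lam mu,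
        H.beta = ((2 : ℂ) ^ H.eps) • prodB I ↔ tau I = tau (J H) := fun H => by
      rw [tau_injective.eq_iff, ← prodB_injective.eq_iff, hJ H,
        smul_right_inj (pow_ne_zero _ (two_ne_zero' ℂ)), eq_comm]
    rw [MvPowerSeries.WithPiTopology.hasSum_iff_hasSum_coeff]
    intro m
    -- For each monomial only the finitely many multinetworks of that exponent contribute, so the
    -- infinite sum is finite in every coefficient.
    have hcoeff : MvPowerSeries.coeff m (imm (fTau (tau I)) (hadamardJT n lam mu)) =
        ∑ H ∈ (Multinetwork.ofExponent n lam mu m).subtype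
          (fun H => H.beta = ((2 : ℂ) ^ H.eps) • prodB I),
          MvPowerSeries.coeff m (((2 : ℂ) ^ H.1.eps) • H.1.wt) := by
      rw [Finset.sum_subtype_eq_sum_filter (f := fun H : Multinetwork n lam mu =>
        MvPowerSeries.coeff m (((2 : ℂ) ^ H.eps) • H.wt)), Finset.sum_filter,
        Multinetwork.coeff_imm]
      refine Finset.sum_congr rfl fun H hH => ?_
      rw [Multinetwork.sum_fTau_mul_beta_coeff (hJ H), MvPowerSeries.coeff_smul, Multinetwork.coeff_wt,
        if_pos hH, mul_one]
      exact if_congr (hiff H).symm rfl rfl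
    rw [hcoeff]
    refine hasSum_sum_of_ne_finset_zero fun H hH => ?_
    rw [Finset.mem_subtype] at hH
    rw [MvPowerSeries.coeff_smul, Multinetwork.coeff_wt, if_neg hH, mul_zero]
  · ext m
    rw [Multinetwork.coeff_imm, map_zero]
    refine Finset.sum_eq_zero fun H _ => ?_
    rw [Multinetwork.sum_fTau_mul_beta_coeff (hJ H), if_neg]
    exact fun h => hτ ⟨J H, isTauOf_iff.2 h⟩
  · refine IsIntegrallyMonomialPositive.isMonomialPositive
      (Multinetwork.isIntegrallyMonomialPositive_imm _ fun H => ?_)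
    refine ⟨if τ = tau (J H) then 2 ^ H.eps else 0, ?_⟩
    rw [Multinetwork.sum_fTau_mul_beta_coeff (hJ H)]
    push_cast
    rfl
  · rw [det_eq_imm]
    refine Multinetwork.isIntegrallyMonomialPositive_imm _ fun H => ?_
    -- The sign takes `B(J H)` to 1 if `J H` is empty and to 0 otherwise.
    refine ⟨if J H = ∅ then 2 ^ H.eps else 0, ?_⟩
    have : ∑ w, ((Equiv.Perm.sign w : ℤ) : ℂ) * H.beta.coeff (.op w) = signHom n H.beta := by
      conv_rhs => rw [symAlg_eq_sum H.beta]
      simp only [map_sum, map_smul, signHom_perm, smul_eq_mul, mul_comm]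
    rw [this, hJ H, map_smul, signHom_prodB]
    split_ifs <;> simp
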